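/- Let $\{X_t\}_{t\in\mathbb Z}$ be a real-valued, zero mean, weakly stationary time series on a probability space $(\Omega,\mathcal F,P)$ with autocovariances $c(r)=\mathrm{cov}(X_0,X_{-r})$, and suppose that it has a spectral density $f(\omega)=\sum_{r\in\mathbb Z}c(r)e^{ir\omega}$ (a square integrable function on $[0,2\pi)$, the series converging in $L_2([0,2\pi))$) with $0<\inf_\omega f(\omega)\le\sup_\omega f(\omega)<\infty$. Then $f$ has a unique factorization $$f(\omega)=\sigma^2|\psi(\omega)|^2=\sigma^2|\phi(\omega)|^{-2},\qquad \sigma>0,\quad \psi(\omega)=1+\sum_{j=1}^\infty\psi_je^{ij\omega},\quad \phi(\omega)=\psi(\omega)^{-1}=1-\sum_{j=1}^\infty\phi_je^{ij\omega},$$ with real square summable $(\psi_j)$ and $(\phi_j)$. For $\ell\ge0$ put $\phi_\ell(\omega)=\sum_{s=1}^\infty\phi_{\ell+s}e^{is\omega}$. Let $\mathcal H_0$ be the closed subspace of the real Hilbert space $L_2(\Omega,\mathcal F,P)$ spanned by $\{X_j:j\le0\}$, let $P_{\mathcal H_0}$ be the orthogonal projection onto it, and let $Y\in L_2(\Omega,\mathcal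 F,P)$. Then there is a unique real sequence $(h_j)_{j\ge0}$ with $P_{\mathcal H_0}(Y)=\sum_{j=0}^\infty h_jX_{-j}$ (convergence in $L_2(\Omega,\mathcal F,P)$), and with $c_{YX}(\ell)=\mathrm{cov}(Y,X_{-\ell})$ the sequences $(h_j)_{j\ge0}$ and $(c_{YX}(\ell))_{\ell\ge0}$ are square summable. Moreover $H(\omega)=\sum_{j=0}^\infty h_je^{ij\omega}$ satisfies $$H(\omega)=\frac{\sum_{\ell=0}^\infty c_{YX}(\ell)\bigl(e^{i\ell\omega}+\psi(\omega)^*\phi_\ell(\omega)^*\bigr)}{f(\omega)}$$ and $$H(\omega)=\sigma^{-2}\phi(\omega)\sum_{\ell=0}^\infty c_{YX}(\ell)\Bigl(e^{i\ell\omega}-\sum_{s=1}^{\ell}\phi_se^{i(\ell-s)\omega}\Bigr),$$ where $^*$ denotes complex conjugation, the sum $\sum_{s=1}^{0}$ is $0$, both series over $\ell$ converge (unconditionally) in $L_2([0,2\pi))$, all series defining functions of $\omega$ are taken in $L_2([0,2\pi))$, and equalities between functions of $\omega$ hold for almost every $\omega$. -/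

import Mathlib

open MeasureTheory ProbabilityTheory Filter Topology
open scoped ENNReal Real ComplexConjugate

noncomputable section

/-! ### Weakly stationary time series -/

/-- A real-valued, zero mean, weakly stationary time series with finite second moments. -/
structure IsWeaklyStationary {Ω : Type*} [MeasurableSpace Ω] (P : Measure Ω)
    (X : ℤ → Ω → ℝ) : Prop where
  memLp : ∀ t, MemLp (X t) 2 P
  mean_zero : ∀ t, ∫ x, X t x ∂P = 0
  cov_shift : ∀ s t k, cov[X (s + k), X (t + k); P] = cov[X s, X t; P]

/-- The autocovariance function `c(r) = cov(X_0, X_{-r})`. -/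
def autocov {Ω : Type*} [MeasurableSpace Ω] (P : Measure Ω) (X : ℤ → Ω → ℝ) (r : ℤ) : ℝ :=
  cov[X 0, X (-r); P]

/-- The cross-covariances `c_{YX}(ℓ) = cov(Y, X_{-ℓ})`, `ℓ ≥ 0`. -/
def crossCov {Ω : Type*} [MeasurableSpace Ω] (P : Measure Ω) (Y : Ω → ℝ) (X : ℤ → Ω → ℝ)
    (l : ℕ) : ℝ :=
  cov[Y, X (-(l : ℤ)); P]

/-- The closed subspace `H_t` of the real Hilbert space `L²(Ω, P)` spanned by `X_j`, `j ≤ t`. -/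
def pastSpace {Ω : Type*} [MeasurableSpace Ω] (P : Measure Ω) (X : ℤ → Ω → ℝ)
    (hX : ∀ t, MemLp (X t) 2 P) (t : ℤ) : Submodule ℝ (Lp ℝ 2 P) :=
  (Submodule.span ℝ {U : Lp ℝ 2 P | ∃ j ≤ t, U = (hX j).toLp (X j)}).topologicalClosure

/-- `pastSpace` is closed in a complete space, so that orthogonal projection onto it exists. -/
instance {Ω : Type*} [MeasurableSpace Ω] (P : Measure Ω) (X : ℤ → Ω → ℝ)
    (hX : ∀ t, MemLp (X t) 2 P) (t : ℤ) : (pastSpace P X hX t).HasOrthogonalProjection := by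
  unfold pastSpace
  infer_instance

/-- `P_{H_0}(Y) = ∑_{j ≥ 0} h_j X_{-j}`: the partial sums converge in `L²(Ω, P)` to the orthogonal
projection of `Y` onto `H_0`. -/
def IsProjectionExpansion {Ω : Type*} [MeasurableSpace Ω] (P : Measure Ω) (X : ℤ → Ω → ℝ)
    (hX : ∀ t, MemLp (X t) 2 P) (Y : Ω → ℝ) (hY : MemLp Y 2 P) (h : ℕ → ℝ) : Prop :=
  Tendsto (fun N : ℕ => ∑ j ∈ Finset.range N, h j • (hX (-(j : ℤ))).toLp (X (-(j : ℤ)))) atTop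
    (𝓝 ((pastSpace P X hX 0).starProjection (hY.toLp Y)))

/-! ### Fourier transforms

Functions of the frequency `ω ∈ [0, 2π)` are functions on `AddCircle (2 * π)`, with the normalized
Haar measure `dω / 2π`; there `fourier n ω = exp (i n ω)`. -/

instance fact_two_pi_pos : Fact ((0 : ℝ) < 2 * π) := ⟨Real.two_pi_pos⟩

/-- The normalized Haar measure `dω / 2π` on the frequency circle. -/
abbrev freqMeasure : Measure (AddCircle (2 * π)) := AddCircle.haarAddCircle

theorem fourier_eq_exp (n : ℤ) (w : ℝ) :
    fourier n (w : AddCircle (2 * π)) = Complex.exp (Complex.I * n * w) := by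
  rw [fourier_coe_apply]
  congr 1
  have : (π : ℂ) ≠ 0 := by exact_mod_cast Real.pi_ne_zero
  push_cast
  field_simp

/-- `F(v)(ω) = ∑_{j ∈ ℤ} v_j e^{ijω}`, the sum being taken in `L²`
(meaningful for `v` in `ℓ²(ℤ)`). -/
def fourierTransform (v : ℤ → ℂ) : AddCircle (2 * π) → ℂ :=
  ⇑(∑' j : ℤ, v j • (fourierLp 2 j : Lp ℂ 2 freqMeasure))

/-- `∑_{j ≥ 0} a_j e^{ijω}` for a real one-sided sequence, the sum being taken in `L²`
(meaningful for `a` in `ℓ²(ℕ)`). -/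
def causalTransform (a : ℕ → ℝ) : AddCircle (2 * π) → ℂ :=
  fourierTransform (fun j => if 0 ≤ j then (a j.toNat : ℂ) else 0)

/-- The series of functions `∑_ℓ u_ℓ(ω)` converges unconditionally in `L²` to `G(ω)`. -/
def HasSumL2 (u : ℕ → AddCircle (2 * π) → ℂ) (G : AddCircle (2 * π) → ℂ) : Prop :=
  (∀ l, MemLp (u l) 2 freqMeasure) ∧
  MemLp G 2 freqMeasure ∧
  Tendsto (fun s : Finset ℕ =>
    eLpNorm (fun w => ∑ l ∈ s, u l w - G w) 2 freqMeasure) atTop (𝓝 0)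

/-! ### Spectral density and spectral factorization -/

/-- `f` is the spectral density of the autocovariance sequence `c`: `c` is square summable and
`f(ω) = ∑_{r ∈ ℤ} c(r) e^{irω}` (as elements of `L²`). -/
structure IsSpectralDensity (c : ℤ → ℝ) (f : AddCircle (2 * π) → ℝ) : Prop where
  memlp : Memℓp c 2
  eq_transform : ∀ᵐ w ∂freqMeasure,
    (f w : ℂ) = fourierTransform (fun r => (c r : ℂ)) w

/-- `0 < inf f ≤ sup f < ∞`, infimum and supremum being essential ones. -/
def IsBoundedAwayFromZeroAndInfinity (f : AddCircle (2 * π) → ℝ) : Prop :=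
  ∃ m M : ℝ, 0 < m ∧ ∀ᵐ w ∂freqMeasure, m ≤ f w ∧ f w ≤ M

/-- `ψ(ω) = 1 + ∑_{j ≥ 1} ψ_j e^{ijω}`, with the convention `ψ_0 = 1`. -/
def psiFun (ψ : ℕ → ℝ) : AddCircle (2 * π) → ℂ :=
  causalTransform ψ

/-- `φ(ω) = 1 - ∑_{j ≥ 1} φ_j e^{ijω}`, with the convention `φ_0 = -1`. -/
def phiFun (φ : ℕ → ℝ) : AddCircle (2 * π) → ℂ :=
  causalTransform (fun j => -φ j)

/-- `φ_ℓ(ω) = ∑_{s ≥ 1} φ_{ℓ+s} e^{isω}`. -/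
def phiTail (φ : ℕ → ℝ) (l : ℕ) : AddCircle (2 * π) → ℂ :=
  causalTransform (fun s => if s = 0 then 0 else φ (l + s))

/-- The factorization `f(ω) = σ² |ψ(ω)|² = σ² |φ(ω)|⁻²` with `σ > 0`,
`ψ(ω) = 1 + ∑_{j ≥ 1} ψ_j e^{ijω}` and `φ(ω) = ψ(ω)⁻¹ = 1 - ∑_{j ≥ 1} φ_j e^{ijω}`, where
`(φ_j)` and `(ψ_j)` are square summable. -/
structure IsSpectralFactorization (f : AddCircle (2 * π) → ℝ) (σ : ℝ) (φ ψ : ℕ → ℝ) : Prop where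
  sigma_pos : 0 < σ
  phi_zero : φ 0 = -1
  psi_zero : ψ 0 = 1
  phi_memlp : Memℓp φ 2
  psi_memlp : Memℓp ψ 2
  mul_eq_one : ∀ᵐ w ∂freqMeasure, phiFun φ w * psiFun ψ w = 1
  eq_psi : ∀ᵐ w ∂freqMeasure, f w = σ ^ 2 * ‖psiFun ψ w‖ ^ 2
  eq_phi : ∀ᵐ w ∂freqMeasure, f w = σ ^ 2 * (‖phiFun φ w‖ ^ 2)⁻¹

end

noncomputable section

/-! ### Fourier coefficients of square integrable functions -/

/-! Write H for the transfer function of the projection. Since the squared norm of `∑ v_j X_{-j}` is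
the integral of `f |∑ v_j e^{ijω}|²`, the bounds on f make the lags a Riesz sequence
(`IsWeaklyStationary.isRieszSequence`). Hence `ℓ²` is isomorphic to the past space, and the
expansion exists, is unique and has square summable coefficients. Orthogonality of the residual says
that fH has Fourier coefficients `c_{YX}(ℓ)` at all ℓ ≥ 0
(`IsProjectionExpansion.fourierCoeff_mul`).

The factorization comes from prediction: for Y = X_1 these equations say that fφ, with φ = 1 -
e^{iω}H, has no positive frequencies. Then f|φ|² = φ^* (fφ) has none either; being real it has no
negative ones, so it is a constant σ², and ψ = σ⁻²(fφ)^* is a causal inverse of φ. For two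
factorizations, ψ'φ and a multiple of its conjugate are both causal, which forces ψ'φ = 1.

For general Y, φ^* fH = σ²ψH is causal. Multiplication by φ^* never raises frequencies, so the
unknown negative coefficients of fH do not matter: σ²ψH is the causal part of φ^* ∑ c_{YX}(ℓ)
e^{iℓω}. Taking this bounded operator inside the sum (`IsSpectralFactorization.hasSum_causalPart`)
gives the second formula after multiplication by σ⁻²φ, and the first after multiplication by ψ^*. -/

theorem memLp_fourierTransform (v : ℤ → ℂ) : MemLp (fourierTransform v) 2 freqMeasure :=
  Lp.memLp _

theorem memℓp_two_iff {ι E : Type*} [NormedAddCommGroup E] {a : ι → E} :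
    Memℓp a 2 ↔ Summable fun i => ‖a i‖ ^ 2 := by
  rw [memℓp_gen_iff (by norm_num)]
  simp

theorem fourierCoeff_fourierTransform {v : ℤ → ℂ} (hv : Memℓp v 2) (n : ℤ) :
    fourierCoeff (fourierTransform v) n = v n := by
  have h := (fourierBasis (T := 2 * π)).hasSum_repr_symm (⟨v, hv⟩ : lp (fun _ : ℤ => ℂ) 2)
  rw [coe_fourierBasis] at h
  have h2 : (∑' j : ℤ, v j • (fourierLp 2 j : Lp ℂ 2 freqMeasure)) =
      (fourierBasis (T := 2 * π)).repr.symm (⟨v, hv⟩ : lp (fun _ : ℤ => ℂ) 2) := h.tsum_eq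
  rw [fourierTransform, h2, ← fourierBasis_repr, LinearIsometryEquiv.apply_symm_apply]

theorem fourierCoeff_toLp_eq {g : AddCircle (2 * π) → ℂ} (hg : MemLp g 2 freqMeasure) :
    fourierCoeff (hg.toLp g) = fourierCoeff g :=
  fourierCoeff_congr_ae hg.coeFn_toLp

theorem Lp_ext_fourierCoeff {g h : Lp ℂ 2 freqMeasure}
    (H : ∀ n : ℤ, fourierCoeff g n = fourierCoeff h n) : g = h := by
  apply fourierBasis.repr.injective
  ext n
  rw [fourierBasis_repr, fourierBasis_repr, H]

theorem ae_eq_of_fourierCoeff_eq {g h : AddCircle (2 * π) → ℂ} (hg : MemLp g 2 freqMeasure)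
    (hh : MemLp h 2 freqMeasure) (H : ∀ n : ℤ, fourierCoeff g n = fourierCoeff h n) :
    g =ᵐ[freqMeasure] h := by
  have : hg.toLp g = hh.toLp h := Lp_ext_fourierCoeff fun n => by
    rw [fourierCoeff_toLp_eq, fourierCoeff_toLp_eq, H]
  exact (MemLp.toLp_eq_toLp_iff hg hh).1 this

theorem memℓp_fourierCoeff {g : AddCircle (2 * π) → ℂ} (hg : MemLp g 2 freqMeasure) :
    Memℓp (fourierCoeff g) 2 := by
  have h := lp.memℓp (fourierBasis.repr (hg.toLp g))
  have : (fourierBasis.repr (hg.toLp g) : ℤ → ℂ) = fourierCoeff g := by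
    ext n
    rw [fourierBasis_repr, fourierCoeff_toLp_eq]
  rwa [this] at h

theorem integrable_of_memLp_two {g : AddCircle (2 * π) → ℂ} (hg : MemLp g 2 freqMeasure) :
    Integrable g freqMeasure :=
  hg.integrable (by norm_num)

theorem memLp_fourier_mul {g : AddCircle (2 * π) → ℂ} (hg : MemLp g 2 freqMeasure) (n : ℤ) :
    MemLp (fun w => fourier n w * g w) 2 freqMeasure := by
  refine hg.of_le ((map_continuous (fourier n)).aestronglyMeasurable.mul hg.1)
    (ae_of_all _ fun w => ?_)
  rw [norm_mul, fourier_apply, Circle.norm_coe, one_mul]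

theorem memLp_conj {g : AddCircle (2 * π) → ℂ} {p : ℝ≥0∞} (hg : MemLp g p freqMeasure) :
    MemLp (fun w => conj (g w)) p freqMeasure :=
  hg.star

theorem memLp_two_fourier (n : ℤ) :
    MemLp (fun w : AddCircle (2 * π) => fourier n w) 2 freqMeasure := by
  simpa [-fourier_apply] using memLp_fourier_mul (memLp_const (1 : ℂ)) n

theorem fourierCoeff_conj (g : AddCircle (2 * π) → ℂ) (n : ℤ) :
    fourierCoeff (fun w => conj (g w)) n = conj (fourierCoeff g (-n)) := by
  simp only [fourierCoeff, ← integral_conj, smul_eq_mul, map_mul, neg_neg, fourier_neg]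

theorem fourierCoeff_fourier_mul (g : AddCircle (2 * π) → ℂ) (k n : ℤ) :
    fourierCoeff (fun w => fourier k w * g w) n = fourierCoeff g (n - k) := by
  simp only [fourierCoeff, smul_eq_mul, ← mul_assoc, ← fourier_add]
  congr 1
  ext w
  congr 3
  ring

theorem fourierCoeff_fourier_apply (k n : ℤ) :
    fourierCoeff (fun w : AddCircle (2 * π) => fourier k w) n = if n = k then 1 else 0 := by
  rw [show (fun w : AddCircle (2 * π) => fourier k w) = ⇑(fourier (T := 2 * π) k) from rfl,
    fourierCoeff_fourier, Pi.single_apply]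

theorem fourierCoeff_one (n : ℤ) :
    fourierCoeff (fun _ : AddCircle (2 * π) => (1 : ℂ)) n = if n = 0 then 1 else 0 := by
  have := fourierCoeff_fourier_apply 0 n
  simpa only [fourier_zero] using this

/-- The Fourier coefficients of a product are the convolution of the Fourier coefficients. -/
theorem hasSum_fourierCoeff_mul {g h : AddCircle (2 * π) → ℂ} (hg : MemLp g 2 freqMeasure)
    (hh : MemLp h 2 freqMeasure) (n : ℤ) :
    HasSum (fun k => fourierCoeff g (n - k) * fourierCoeff h k)
      (fourierCoeff (fun w => g w * h w) n) := by
  -- The n-th coefficient of gh is the inner product of `e^{inω} g^*` with h, so the claim is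
  -- Parseval's identity for this pair.
  have hg' := memLp_fourier_mul (memLp_conj hg) n
  have H := fourierBasis.hasSum_inner_mul_inner (hg'.toLp _) (hh.toLp h)
  have e1 (k : ℤ) : inner ℂ (hg'.toLp _) (fourierBasis k) * inner ℂ (fourierBasis k) (hh.toLp h) =
      fourierCoeff g (n - k) * fourierCoeff h k := by
    rw [← fourierBasis.repr_apply_apply, fourierBasis_repr, fourierCoeff_toLp_eq,
      ← inner_conj_symm, ← fourierBasis.repr_apply_apply, fourierBasis_repr,
      fourierCoeff_toLp_eq, fourierCoeff_fourier_mul, fourierCoeff_conj]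
    simp
  have e2 : inner ℂ (hg'.toLp _) (hh.toLp h) = fourierCoeff (fun w => g w * h w) n := by
    rw [L2.inner_def, fourierCoeff]
    refine integral_congr_ae ?_
    filter_upwards [hg'.coeFn_toLp, hh.coeFn_toLp] with w h1 h2
    rw [h1, h2, RCLike.inner_apply, fourier_neg, smul_eq_mul, map_mul, Complex.conj_conj]
    ring
  simpa only [e1, e2] using H

/-- An integrable nonnegative function whose only nonzero Fourier coefficient is the mean is
almost everywhere constant. -/
theorem ae_eq_const_of_fourierCoeff_eq_zero {g : AddCircle (2 * π) → ℝ}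
    (hg : Integrable g freqMeasure) (hg0 : ∀ᵐ w ∂freqMeasure, 0 ≤ g w)
    (h : ∀ n : ℤ, n ≠ 0 → fourierCoeff (fun w => (g w : ℂ)) n = 0) :
    ∀ᵐ w ∂freqMeasure, g w = ∫ w, g w ∂freqMeasure := by
  -- As g is only integrable, the `L²` basis does not apply; the finite measures with densities g
  -- and K are compared instead.
  set K := ∫ w, g w ∂freqMeasure with hK
  have hK0 : 0 ≤ K := integral_nonneg_of_ae hg0
  have hm : AEMeasurable (fun w => ENNReal.ofReal (g w)) freqMeasure :=
    hg.1.aemeasurable.ennreal_ofReal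
  have hfin : ∫⁻ w, ENNReal.ofReal (g w) ∂freqMeasure ≠ ∞ := by
    rw [← ofReal_integral_eq_lintegral_ofReal hg hg0]
    exact ENNReal.ofReal_ne_top
  have : IsFiniteMeasure (freqMeasure.withDensity fun w => ENNReal.ofReal (g w)) :=
    isFiniteMeasure_withDensity hfin
  have : IsFiniteMeasure (freqMeasure.withDensity fun _ => ENNReal.ofReal K) :=
    isFiniteMeasure_withDensity (by simp)
  have hint1 (F : C(AddCircle (2 * π), ℂ)) :
      ∫ w, F w ∂(freqMeasure.withDensity fun w => ENNReal.ofReal (g w)) =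
        ∫ w, F w * (g w : ℂ) ∂freqMeasure := by
    rw [integral_withDensity_eq_integral_toReal_smul₀ hm (by simp)]
    refine integral_congr_ae ?_
    filter_upwards [hg0] with w hw
    rw [ENNReal.toReal_ofReal hw, Complex.real_smul, mul_comm]
  have hint2 (F : C(AddCircle (2 * π), ℂ)) :
      ∫ w, F w ∂(freqMeasure.withDensity fun _ => ENNReal.ofReal K) =
        ∫ w, F w * (K : ℂ) ∂freqMeasure := by
    rw [integral_withDensity_eq_integral_toReal_smul₀ (by fun_prop) (by simp)]
    simp only [ENNReal.toReal_ofReal hK0, Complex.real_smul, mul_comm]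
  have hgi (F : C(AddCircle (2 * π), ℂ)) :
      Integrable (fun w => F w * (g w : ℂ)) freqMeasure := by
    refine hg.ofReal.bdd_mul (c := ‖F‖) F.continuous.aestronglyMeasurable ?_
    exact ae_of_all _ fun w => F.norm_coe_le_norm w
  have hKi (F : C(AddCircle (2 * π), ℂ)) :
      Integrable (fun w => F w * (K : ℂ)) freqMeasure := by
    refine Integrable.mul_const ?_ _
    exact (map_continuous F).integrable_of_hasCompactSupport (HasCompactSupport.of_compactSpace F)
  have key : ∀ F ∈ Submodule.span ℂ (Set.range (fourier (T := 2 * π))),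
      ∫ w, F w * (g w : ℂ) ∂freqMeasure = ∫ w, F w * (K : ℂ) ∂freqMeasure := by
    intro F hF
    induction hF using Submodule.span_induction with
    | mem F hF =>
      obtain ⟨n, rfl⟩ := hF
      have e1 : ∫ w, fourier n w * (g w : ℂ) ∂freqMeasure =
          fourierCoeff (fun w => (g w : ℂ)) (-n) := by
        simp only [fourierCoeff, neg_neg, smul_eq_mul]
      have e2 : ∫ w, fourier n w * (K : ℂ) ∂freqMeasure = (if n = 0 then 1 else 0) * (K : ℂ) := by
        rw [integral_mul_const]
        congr 1
        have := fourierCoeff_one (-n)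
        simp only [fourierCoeff, neg_neg, smul_eq_mul, mul_one, neg_eq_zero] at this
        exact this
      rw [e1, e2]
      rcases eq_or_ne n 0 with rfl | hn
      · simp only [fourierCoeff, neg_zero, fourier_zero, one_smul, if_true, one_mul]
        exact integral_ofReal
      · rw [h _ (neg_ne_zero.2 hn), if_neg hn, zero_mul]
    | zero => simp
    | add F₁ F₂ _ _ h1 h2 =>
      simp only [ContinuousMap.add_apply, add_mul]
      rw [integral_add (hgi F₁) (hgi F₂), integral_add (hKi F₁) (hKi F₂), h1, h2]
    | smul a F _ h1 =>
      simp only [ContinuousMap.smul_apply, smul_eq_mul, mul_assoc]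
      rw [integral_const_mul, integral_const_mul, h1]
  have hmeas : (freqMeasure.withDensity fun w => ENNReal.ofReal (g w)) =
      freqMeasure.withDensity fun _ => ENNReal.ofReal K := by
    let A : StarSubalgebra ℂ (BoundedContinuousFunction (AddCircle (2 * π)) ℂ) :=
      (fourierSubalgebra (T := 2 * π)).comap (BoundedContinuousFunction.toContinuousMapStarₐ ℂ)
    -- Trigonometric polynomials form a point-separating star subalgebra, so their integrals
    -- determine a finite measure.
    refine ext_of_forall_mem_subalgebra_integral_eq_of_pseudoEMetric_complete_countable
      (𝕜 := ℂ) (A := A) ?_ ?_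
    · intro x y hxy
      obtain ⟨_, ⟨F, hF, rfl⟩, hne⟩ := fourierSubalgebra_separatesPoints (T := 2 * π) hxy
      refine ⟨_, ⟨F, ⟨BoundedContinuousFunction.mkOfCompact F, ?_, ?_⟩, rfl⟩, hne⟩
      · exact hF
      · ext; rfl
    · intro F hF
      have hF' : (BoundedContinuousFunction.toContinuousMapStarₐ ℂ F) ∈
          Submodule.span ℂ (Set.range (fourier (T := 2 * π))) := by
        rw [← fourierSubalgebra_coe]
        exact hF
      have := key _ hF'
      rw [← hint1, ← hint2] at this
      exact this
  have hae := (withDensity_eq_iff hm (by fun_prop) hfin).1 hmeas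
  filter_upwards [hae, hg0] with w hw hw0
  exact (ENNReal.ofReal_eq_ofReal_iff hw0 hK0).1 hw

/-! ### Riesz sequences in a real Hilbert space -/

/-- A sequence `x` whose finite linear combinations have norms comparable with the `ℓ²` norms of
their coefficients. -/
def IsRieszSequence {E : Type*} [NormedAddCommGroup E] [NormedSpace ℝ E] (m M : ℝ) (x : ℕ → E) :
    Prop :=
  ∀ (s : Finset ℕ) (v : ℕ → ℝ), m * ∑ j ∈ s, v j ^ 2 ≤ ‖∑ j ∈ s, v j • x j‖ ^ 2 ∧
    ‖∑ j ∈ s, v j • x j‖ ^ 2 ≤ M * ∑ j ∈ s, v j ^ 2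

namespace IsRieszSequence

variable {E : Type*} [NormedAddCommGroup E] [InnerProductSpace ℝ E]
  {m M : ℝ} {x : ℕ → E}

theorem summable [CompleteSpace E] (hx : IsRieszSequence m M x) {v : ℕ → ℝ} (hv : Memℓp v 2) :
    Summable fun j => v j • x j := by
  have hv2 : Summable fun j => v j ^ 2 := by
    rw [memℓp_gen_iff (by norm_num)] at hv
    simpa using hv
  rw [summable_iff_vanishing_norm]
  intro ε hε
  -- No sign of M is assumed, so `|M| + 1` serves as a positive upper constant.
  have hM' : 0 < |M| + 1 := by positivity
  obtain ⟨s, hs⟩ := summable_iff_vanishing_norm.1 hv2 (ε ^ 2 / (|M| + 1)) (by positivity)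
  refine ⟨s, fun t ht => ?_⟩
  have h1 := hs t ht
  rw [Real.norm_of_nonneg (Finset.sum_nonneg fun j _ => sq_nonneg _), lt_div_iff₀ hM'] at h1
  have h2 := (hx t v).2
  have h3 : M * ∑ j ∈ t, v j ^ 2 ≤ (|M| + 1) * ∑ j ∈ t, v j ^ 2 :=
    mul_le_mul_of_nonneg_right (by linarith [le_abs_self M])
      (Finset.sum_nonneg fun j _ => sq_nonneg _)
  exact lt_of_pow_lt_pow_left₀ 2 hε.le (by linarith)

/-- Convergent partial sums are bounded, and the lower Riesz bound passes this on to the sums of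
squares. Uniqueness thereby holds among all real sequences, not only those in `ℓ²`. -/
theorem memℓp_of_tendsto (hx : IsRieszSequence m M x) (hm : 0 < m) {v : ℕ → ℝ} {y : E}
    (h : Tendsto (fun N => ∑ j ∈ Finset.range N, v j • x j) atTop (𝓝 y)) : Memℓp v 2 := by
  obtain ⟨C, hC⟩ := (h.norm.pow 2).bddAbove_range
  rw [memℓp_gen_iff (by norm_num)]
  simp only [ENNReal.toReal_ofNat, Real.rpow_ofNat, Real.norm_eq_abs, sq_abs]
  refine summable_of_sum_range_le (c := C / m) (fun j => sq_nonneg _) fun N => ?_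
  rw [le_div_iff₀ hm, mul_comm]
  exact (hx (Finset.range N) v).1.trans (hC ⟨N, rfl⟩)

theorem norm_sq_bounds [CompleteSpace E] (hx : IsRieszSequence m M x) (v : lp (fun _ : ℕ => ℝ) 2) :
    m * ‖v‖ ^ 2 ≤ ‖∑' j, v j • x j‖ ^ 2 ∧ ‖∑' j, v j • x j‖ ^ 2 ≤ M * ‖v‖ ^ 2 := by
  have h1 := (hx.summable (lp.memℓp v)).hasSum.norm.pow 2
  have h2 : HasSum (fun j => v j ^ 2) (‖v‖ ^ 2) := by
    have := lp.hasSum_norm (p := 2) (by norm_num) v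
    simpa using this
  exact ⟨le_of_tendsto_of_tendsto' (h2.const_mul m) h1 fun s => (hx s v).1,
    le_of_tendsto_of_tendsto' h1 (h2.const_mul M) fun s => (hx s v).2⟩

/-- The synthesis operator `v ↦ ∑ j, v j • x j` of a Riesz sequence. -/
def synthesis [CompleteSpace E] (hx : IsRieszSequence m M x) : lp (fun _ : ℕ => ℝ) 2 →L[ℝ] E :=
  LinearMap.mkContinuous
    { toFun := fun v => ∑' j, v j • x j
      map_add' := fun v w => by
        simp only [lp.coeFn_add, Pi.add_apply, add_smul]
        exact (hx.summable (lp.memℓp v)).tsum_add (hx.summable (lp.memℓp w))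
      map_smul' := fun c v => by
        simp only [lp.coeFn_smul, Pi.smul_apply, smul_eq_mul, mul_smul, RingHom.id_apply]
        exact (hx.summable (lp.memℓp v)).tsum_const_smul c }
    (√M) fun v => by
      have h := (hx.norm_sq_bounds v).2
      change ‖∑' j, v j • x j‖ ≤ √M * ‖v‖
      rcases le_or_gt 0 M with hM | hM
      · refine le_of_sq_le_sq ?_ (by positivity)
        rwa [mul_pow, Real.sq_sqrt hM]
      · have : M * ‖v‖ ^ 2 ≤ 0 := mul_nonpos_of_nonpos_of_nonneg hM.le (sq_nonneg _)
        have h0 : ‖∑' j, v j • x j‖ = 0 := pow_eq_zero_iff two_ne_zero |>.1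
          (le_antisymm (h.trans this) (sq_nonneg _))
        rw [h0]
        positivity

theorem hasSum_synthesis [CompleteSpace E] (hx : IsRieszSequence m M x)
    (v : lp (fun _ : ℕ => ℝ) 2) : HasSum (fun j => v j • x j) (hx.synthesis v) :=
  (hx.summable (lp.memℓp v)).hasSum

/-- The lower Riesz bound, in the form that yields injectivity and closed range. -/
theorem antilipschitz_synthesis [CompleteSpace E] (hx : IsRieszSequence m M x) (hm : 0 < m) :
    AntilipschitzWith (Real.toNNReal (√m)⁻¹) hx.synthesis := by
  refine hx.synthesis.antilipschitz_of_bound fun v => ?_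
  have h : m * ‖v‖ ^ 2 ≤ ‖hx.synthesis v‖ ^ 2 := (hx.norm_sq_bounds v).1
  have hs : 0 < √m := Real.sqrt_pos.2 hm
  rw [Real.coe_toNNReal _ (by positivity), inv_mul_eq_div, le_div_iff₀ hs]
  refine le_of_sq_le_sq ?_ (norm_nonneg _)
  rw [mul_pow, Real.sq_sqrt hm.le, mul_comm]
  exact h

/-- The range is closed and contains every `x i` as the image of a unit vector, hence contains the
closed span. -/
theorem mem_range_synthesis [CompleteSpace E] (hx : IsRieszSequence m M x) (hm : 0 < m) {y : E}
    (hy : y ∈ (Submodule.span ℝ (Set.range x)).topologicalClosure) :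
    ∃ v, hx.synthesis v = y := by
  have hc : IsClosed (Set.range hx.synthesis) :=
    (hx.antilipschitz_synthesis hm).isClosed_range hx.synthesis.uniformContinuous
  have hle : Submodule.span ℝ (Set.range x) ≤ LinearMap.range hx.synthesis.toLinearMap := by
    rw [Submodule.span_le]
    rintro _ ⟨i, rfl⟩
    refine ⟨lp.single 2 i 1, ?_⟩
    refine (hx.hasSum_synthesis _).unique ?_
    convert hasSum_single i ?_ using 1
    · simp
    · intro j hj
      simp [hj]
  have := Submodule.topologicalClosure_minimal _ hle hc
  exact this hy

theorem existsUnique_tendsto [CompleteSpace E] (hx : IsRieszSequence m M x) (hm : 0 < m) {y : E}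
    (hy : y ∈ (Submodule.span ℝ (Set.range x)).topologicalClosure) :
    ∃! v : ℕ → ℝ, Tendsto (fun N => ∑ j ∈ Finset.range N, v j • x j) atTop (𝓝 y) := by
  obtain ⟨v, rfl⟩ := hx.mem_range_synthesis hm hy
  refine ⟨v, (hx.hasSum_synthesis v).tendsto_sum_nat, fun w hw => ?_⟩
  have hw2 := hx.memℓp_of_tendsto hm hw
  have h1 := tendsto_nhds_unique hw (hx.hasSum_synthesis ⟨w, hw2⟩).tendsto_sum_nat
  have h2 := (hx.antilipschitz_synthesis hm).injective h1
  rw [h2]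

end IsRieszSequence

/-! ### Causal transforms and spectral densities -/

theorem memℓp_two_ofReal {ι : Type*} {a : ι → ℝ} (ha : Memℓp a 2) :
    Memℓp (fun i => (a i : ℂ)) 2 := by
  rw [memℓp_two_iff] at ha ⊢
  simpa using ha

theorem memℓp_two_extend {a : ℕ → ℝ} (ha : Memℓp a 2) :
    Memℓp (fun j : ℤ => if 0 ≤ j then (a j.toNat : ℂ) else 0) 2 := by
  rw [memℓp_two_iff] at ha ⊢
  rw [← Function.Injective.summable_iff (f := fun j : ℤ => _) Nat.cast_injective]
  · convert ha using 2 with j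
    simp
  · intro j hj
    have : ¬ 0 ≤ j := fun h => hj ⟨j.toNat, Int.toNat_of_nonneg h⟩
    simp [this]

theorem memLp_causalTransform (a : ℕ → ℝ) : MemLp (causalTransform a) 2 freqMeasure :=
  memLp_fourierTransform _

theorem fourierCoeff_causalTransform {a : ℕ → ℝ} (ha : Memℓp a 2) (n : ℤ) :
    fourierCoeff (causalTransform a) n = if 0 ≤ n then (a n.toNat : ℂ) else 0 :=
  fourierCoeff_fourierTransform (memℓp_two_extend ha) n

theorem fourierCoeff_causalTransform_nat {a : ℕ → ℝ} (ha : Memℓp a 2) (n : ℕ) :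
    fourierCoeff (causalTransform a) n = a n := by
  rw [fourierCoeff_causalTransform ha, if_pos (Int.natCast_nonneg n), Int.toNat_natCast]

theorem fourierCoeff_causalTransform_of_neg {a : ℕ → ℝ} (ha : Memℓp a 2) {n : ℤ} (hn : n < 0) :
    fourierCoeff (causalTransform a) n = 0 := by
  rw [fourierCoeff_causalTransform ha, if_neg hn.not_ge]

theorem IsSpectralDensity.memLp {c : ℤ → ℝ} {f : AddCircle (2 * π) → ℝ}
    (hf : IsSpectralDensity c f) : MemLp (fun w => (f w : ℂ)) 2 freqMeasure :=
  (memLp_congr_ae hf.eq_transform).2 (memLp_fourierTransform _)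

theorem IsSpectralDensity.fourierCoeff_eq {c : ℤ → ℝ} {f : AddCircle (2 * π) → ℝ}
    (hf : IsSpectralDensity c f) (r : ℤ) : fourierCoeff (fun w => (f w : ℂ)) r = c r := by
  rw [fourierCoeff_congr_ae hf.eq_transform,
    fourierCoeff_fourierTransform (memℓp_two_ofReal hf.memlp)]

theorem integrable_of_integrable_ofReal {f : AddCircle (2 * π) → ℝ}
    (hf : MemLp (fun w => (f w : ℂ)) 2 freqMeasure) : Integrable f freqMeasure := by
  simpa using (integrable_of_memLp_two hf).re

/-- The quadratic form of the Toeplitz matrix of the Fourier coefficients of `g`. -/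
theorem integral_mul_norm_sq_eq_sum {g : AddCircle (2 * π) → ℝ} (hg : Integrable g freqMeasure)
    (s : Finset ℕ) (v : ℕ → ℝ) :
    ((∫ w, g w * ‖∑ j ∈ s, (v j : ℂ) * fourier (j : ℤ) w‖ ^ 2 ∂freqMeasure : ℝ) : ℂ) =
      ∑ j ∈ s, ∑ k ∈ s,
        (v j : ℂ) * v k * fourierCoeff (fun w => (g w : ℂ)) ((k : ℤ) - j) := by
  have hpt (w : AddCircle (2 * π)) :
      ((g w * ‖∑ j ∈ s, (v j : ℂ) * fourier (j : ℤ) w‖ ^ 2 : ℝ) : ℂ) =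
        ∑ j ∈ s, ∑ k ∈ s, (v j : ℂ) * v k * (fourier (-((k : ℤ) - j)) w • (g w : ℂ)) := by
    push_cast
    rw [← Complex.mul_conj', map_sum, Finset.sum_mul_sum, Finset.mul_sum]
    refine Finset.sum_congr rfl fun j _ => ?_
    rw [Finset.mul_sum]
    refine Finset.sum_congr rfl fun k _ => ?_
    rw [neg_sub, sub_eq_add_neg, fourier_add, fourier_neg, map_mul, Complex.conj_ofReal,
      smul_eq_mul]
    ring
  have hi (n : ℤ) : Integrable (fun w => fourier n w • (g w : ℂ)) freqMeasure :=
    hg.ofReal.fourier_smul n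
  rw [← integral_complex_ofReal]
  simp only [hpt]
  rw [integral_finsetSum _ fun j _ => integrable_finsetSum _ fun k _ => (hi _).const_mul _]
  refine Finset.sum_congr rfl fun j _ => ?_
  rw [integral_finsetSum _ fun k _ => (hi _).const_mul _]
  refine Finset.sum_congr rfl fun k _ => ?_
  rw [integral_const_mul, fourierCoeff]

/-- For a constant symbol only the diagonal of the Toeplitz form survives. -/
theorem integral_norm_sq_trigPoly (m : ℝ) (s : Finset ℕ) (v : ℕ → ℝ) :
    ∫ w, m * ‖∑ j ∈ s, (v j : ℂ) * fourier (j : ℤ) w‖ ^ 2 ∂freqMeasure =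
      m * ∑ j ∈ s, v j ^ 2 := by
  have h := integral_mul_norm_sq_eq_sum (integrable_const m) s v
  have hc (n : ℤ) : fourierCoeff (fun _ : AddCircle (2 * π) => (m : ℂ)) n =
      if n = 0 then (m : ℂ) else 0 := by
    have := fourierCoeff.const_mul (fun _ : AddCircle (2 * π) => (1 : ℂ)) m n
    simpa [fourierCoeff_one] using this
  have h2 : (∑ j ∈ s, ∑ k ∈ s, (v j : ℂ) * v k *
      fourierCoeff (fun _ : AddCircle (2 * π) => (m : ℂ)) ((k : ℤ) - j)) =
      ((m * ∑ j ∈ s, v j ^ 2 : ℝ) : ℂ) := by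
    push_cast
    rw [Finset.mul_sum]
    refine Finset.sum_congr rfl fun j hj => ?_
    rw [Finset.sum_eq_single_of_mem j hj]
    · rw [hc, sub_self, if_pos rfl]
      ring
    · intro k _ hk
      rw [hc, if_neg (by omega), mul_zero]
  rw [h2] at h
  exact_mod_cast h

/-! ### The time series as a Riesz sequence -/

section

variable {Ω : Type*} [MeasurableSpace Ω] {P : Measure Ω} {X : ℤ → Ω → ℝ}

theorem IsWeaklyStationary.cov_neg_neg (hX : IsWeaklyStationary P X) (j l : ℤ) :
    cov[X (-j), X (-l); P] = autocov P X (l - j) := by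
  rw [autocov, ← hX.cov_shift 0 (-(l - j)) (-j)]
  congr 2 <;> ring

/-- The element of `L²` represented by `X_{-j}`. -/
def lagLp (X : ℤ → Ω → ℝ) (hX : ∀ t, MemLp (X t) 2 P) (j : ℕ) : Lp ℝ 2 P :=
  (hX (-(j : ℤ))).toLp (X (-(j : ℤ)))

theorem pastSpace_zero_eq (hX : ∀ t, MemLp (X t) 2 P) :
    pastSpace P X hX 0 = (Submodule.span ℝ (Set.range (lagLp X hX))).topologicalClosure := by
  rw [pastSpace]
  congr 2
  ext U
  constructor
  · rintro ⟨j, hj, rfl⟩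
    refine ⟨(-j).toNat, ?_⟩
    have : -(((-j).toNat : ℕ) : ℤ) = j := by omega
    simp only [lagLp]
    congr 1
    rw [this]
  · rintro ⟨j, rfl⟩
    exact ⟨-(j : ℤ), by omega, rfl⟩

variable [IsProbabilityMeasure P]

/-- One centred factor already kills the product of means, so Y need not be centred. -/
theorem inner_toLp_eq_covariance {U V : Ω → ℝ} (hU : MemLp U 2 P) (hV : MemLp V 2 P)
    (hV0 : ∫ x, V x ∂P = 0) : inner ℝ (hU.toLp U) (hV.toLp V) = cov[U, V; P] := by
  rw [covariance_eq_sub hU hV, hV0, mul_zero, sub_zero, L2.inner_def]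
  refine integral_congr_ae ?_
  filter_upwards [hU.coeFn_toLp, hV.coeFn_toLp] with x h1 h2
  rw [h1, h2]
  simp [mul_comm]

theorem IsWeaklyStationary.inner_lagLp (hX : IsWeaklyStationary P X) (j l : ℕ) :
    inner ℝ (lagLp X hX.memLp j) (lagLp X hX.memLp l) = autocov P X ((l : ℤ) - j) := by
  rw [lagLp, lagLp, inner_toLp_eq_covariance _ _ (hX.mean_zero _), hX.cov_neg_neg]

/-- The Gram matrix of the lags is the Toeplitz matrix of f, so the squared norm is an integral
against f, to be compared with the same integral against m and M. -/
theorem IsWeaklyStationary.isRieszSequence (hX : IsWeaklyStationary P X)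
    {f : AddCircle (2 * π) → ℝ} (hf : IsSpectralDensity (autocov P X) f) {m M : ℝ}
    (hfb : ∀ᵐ w ∂freqMeasure, m ≤ f w ∧ f w ≤ M) :
    IsRieszSequence m M (lagLp X hX.memLp) := by
  intro s v
  have hfi := integrable_of_integrable_ofReal hf.memLp
  set V : C(AddCircle (2 * π), ℂ) := ∑ j ∈ s, (v j : ℂ) • fourier (j : ℤ) with hV
  have hVw (w) : ‖∑ j ∈ s, (v j : ℂ) * fourier (j : ℤ) w‖ = ‖V w‖ := by
    simp [hV, -fourier_apply, ContinuousMap.sum_apply]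
  have key : ‖∑ j ∈ s, v j • lagLp X hX.memLp j‖ ^ 2 =
      ∫ w, f w * ‖∑ j ∈ s, (v j : ℂ) * fourier (j : ℤ) w‖ ^ 2 ∂freqMeasure := by
    have h := integral_mul_norm_sq_eq_sum hfi s v
    rw [← real_inner_self_eq_norm_sq, sum_inner]
    simp only [hf.fourierCoeff_eq] at h
    have h' : (∫ w, f w * ‖∑ j ∈ s, (v j : ℂ) * fourier (j : ℤ) w‖ ^ 2 ∂freqMeasure) =
      ∑ j ∈ s, ∑ k ∈ s, v j * v k * autocov P X ((k : ℤ) - j) := by exact_mod_cast h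
    rw [h']
    refine Finset.sum_congr rfl fun j _ => ?_
    rw [inner_sum]
    refine Finset.sum_congr rfl fun k _ => ?_
    rw [real_inner_smul_left, real_inner_smul_right, hX.inner_lagLp]
    ring
  have hint {g : AddCircle (2 * π) → ℝ} (hg : Integrable g freqMeasure) :
      Integrable (fun w => g w * ‖∑ j ∈ s, (v j : ℂ) * fourier (j : ℤ) w‖ ^ 2) freqMeasure := by
    simp only [hVw]
    refine hg.mul_bdd (c := ‖V‖ ^ 2) (by fun_prop) (ae_of_all _ fun w => ?_)
    rw [norm_pow, norm_norm]
    exact pow_le_pow_left₀ (norm_nonneg _) (V.norm_coe_le_norm w) 2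
  rw [key, ← integral_norm_sq_trigPoly m, ← integral_norm_sq_trigPoly M]
  constructor
  · refine integral_mono_ae (hint (integrable_const m)) (hint hfi) ?_
    filter_upwards [hfb] with w hw
    exact mul_le_mul_of_nonneg_right hw.1 (sq_nonneg _)
  · refine integral_mono_ae (hint hfi) (hint (integrable_const M)) ?_
    filter_upwards [hfb] with w hw
    exact mul_le_mul_of_nonneg_right hw.2 (sq_nonneg _)

variable {Y : Ω → ℝ} {f : AddCircle (2 * π) → ℝ} {h : ℕ → ℝ}

theorem existsUnique_projectionExpansion (hX : IsWeaklyStationary P X)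
    (hf : IsSpectralDensity (autocov P X) f) (hfb : IsBoundedAwayFromZeroAndInfinity f)
    (hY : MemLp Y 2 P) : ∃! h : ℕ → ℝ, IsProjectionExpansion P X hX.memLp Y hY h := by
  obtain ⟨m, M, hm, hb⟩ := hfb
  refine (hX.isRieszSequence hf hb).existsUnique_tendsto hm ?_
  rw [← pastSpace_zero_eq]
  exact Submodule.starProjection_apply_mem _ _

theorem IsProjectionExpansion.memℓp (hX : IsWeaklyStationary P X)
    (hf : IsSpectralDensity (autocov P X) f) (hfb : IsBoundedAwayFromZeroAndInfinity f)
    {hY : MemLp Y 2 P} (hh : IsProjectionExpansion P X hX.memLp Y hY h) : Memℓp h 2 := by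
  obtain ⟨m, M, hm, hb⟩ := hfb
  exact (hX.isRieszSequence hf hb).memℓp_of_tendsto hm hh

/-- The normal equations in the frequency domain. -/
theorem IsProjectionExpansion.fourierCoeff_mul (hX : IsWeaklyStationary P X)
    (hf : IsSpectralDensity (autocov P X) f) (hfb : IsBoundedAwayFromZeroAndInfinity f)
    {hY : MemLp Y 2 P} (hh : IsProjectionExpansion P X hX.memLp Y hY h) (l : ℕ) :
    fourierCoeff (fun w => (f w : ℂ) * causalTransform h w) l = crossCov P Y X l := by
  have hh2 := IsProjectionExpansion.memℓp hX hf hfb hh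
  have h1 : Tendsto (fun N : ℕ => ∑ j ∈ Finset.range N, h j * autocov P X ((l : ℤ) - j)) atTop
      (𝓝 (crossCov P Y X l)) := by
    have := hh.inner (tendsto_const_nhds (x := lagLp X hX.memLp l)) (𝕜 := ℝ)
    have hproj : inner ℝ ((pastSpace P X hX.memLp 0).starProjection (hY.toLp Y))
        (lagLp X hX.memLp l) = crossCov P Y X l := by
      have hmem : lagLp X hX.memLp l ∈ pastSpace P X hX.memLp 0 := by
        rw [pastSpace_zero_eq]
        exact Submodule.le_topologicalClosure _ (Submodule.subset_span ⟨l, rfl⟩)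
      -- The residual is orthogonal to `X_{-l}`, so Y may replace its projection.
      have h0 := Submodule.starProjection_inner_eq_zero (hY.toLp Y) _ hmem
      rw [inner_sub_left, sub_eq_zero] at h0
      rw [← h0, lagLp, inner_toLp_eq_covariance _ _ (hX.mean_zero _), crossCov]
    rw [hproj] at this
    refine this.congr fun N => ?_
    rw [sum_inner]
    refine Finset.sum_congr rfl fun j _ => ?_
    rw [real_inner_smul_left, ← hX.inner_lagLp]
    rfl
  -- Since `h` is causal, the convolution for fH has the same partial sums as `h1`.
  have h2 := hasSum_fourierCoeff_mul hf.memLp (memLp_causalTransform h) l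
  rw [← Function.Injective.hasSum_iff (g := ((↑) : ℕ → ℤ)) Nat.cast_injective] at h2
  · have h3 := h2.tendsto_sum_nat
    have h4 := (Complex.continuous_ofReal.tendsto _).comp h1
    refine tendsto_nhds_unique h3 (h4.congr fun N => ?_)
    simp only [Function.comp_apply, fourierCoeff_causalTransform_nat hh2, hf.fourierCoeff_eq]
    push_cast
    exact Finset.sum_congr rfl fun j _ => mul_comm _ _
  · intro k hk
    rw [fourierCoeff_causalTransform_of_neg hh2, mul_zero]
    by_contra hk0
    exact hk ⟨k.toNat, Int.toNat_of_nonneg (not_lt.1 hk0)⟩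

end

/-! ### Products of one-sided functions -/

theorem fourierCoeff_mul_eq_zero {g h : AddCircle (2 * π) → ℂ} (hg : MemLp g 2 freqMeasure)
    (hh : MemLp h 2 freqMeasure) {n : ℤ}
    (H : ∀ k, fourierCoeff g (n - k) = 0 ∨ fourierCoeff h k = 0) :
    fourierCoeff (fun w => g w * h w) n = 0 := by
  refine (hasSum_fourierCoeff_mul hg hh n).unique ?_
  convert hasSum_zero with k
  exact mul_eq_zero.2 (H k)

/-- If n < 0, then k and n - k cannot both be nonnegative: causal functions are closed under
products. -/
theorem fourierCoeff_mul_of_neg {g h : AddCircle (2 * π) → ℂ} (hg : MemLp g 2 freqMeasure)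
    (hh : MemLp h 2 freqMeasure) (hg0 : ∀ n < 0, fourierCoeff g n = 0)
    (hh0 : ∀ n < 0, fourierCoeff h n = 0) {n : ℤ} (hn : n < 0) :
    fourierCoeff (fun w => g w * h w) n = 0 :=
  fourierCoeff_mul_eq_zero hg hh fun k => by
    rcases lt_or_ge k 0 with hk | hk
    · exact .inr (hh0 k hk)
    · exact .inl (hg0 _ (by omega))

theorem fourierCoeff_mul_zero {g h : AddCircle (2 * π) → ℂ} (hg : MemLp g 2 freqMeasure)
    (hh : MemLp h 2 freqMeasure) (hg0 : ∀ n < 0, fourierCoeff g n = 0)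
    (hh0 : ∀ n < 0, fourierCoeff h n = 0) :
    fourierCoeff (fun w => g w * h w) 0 = fourierCoeff g 0 * fourierCoeff h 0 := by
  refine (hasSum_fourierCoeff_mul hg hh 0).unique ?_
  convert hasSum_single (f := fun k => fourierCoeff g (0 - k) * fourierCoeff h k) 0 ?_ using 1
  · rw [sub_zero]
  · intro k hk
    rcases hk.lt_or_gt with hk | hk
    · rw [hh0 k hk, mul_zero]
    · rw [hg0 _ (by omega), zero_mul]

theorem memLp_two_mul_of_top {g h : AddCircle (2 * π) → ℂ} (hg : MemLp g ∞ freqMeasure)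
    (hh : MemLp h 2 freqMeasure) : MemLp (fun w => g w * h w) 2 freqMeasure :=
  hh.mul hg

theorem memLp_top_of_norm_sq_le {g : AddCircle (2 * π) → ℂ} {C : ℝ}
    (hg : AEStronglyMeasurable g freqMeasure) (h : ∀ᵐ w ∂freqMeasure, ‖g w‖ ^ 2 ≤ C) :
    MemLp g ∞ freqMeasure := by
  refine memLp_top_of_bound hg (√C) ?_
  filter_upwards [h] with w hw
  exact Real.le_sqrt_of_sq_le hw

theorem two_memLp_of_top {g : AddCircle (2 * π) → ℂ} (hg : MemLp g ∞ freqMeasure) :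
    MemLp g 2 freqMeasure :=
  hg.mono_exponent le_top

theorem ae_eq_one_of_fourierCoeff {g : AddCircle (2 * π) → ℂ} (hg : MemLp g 2 freqMeasure)
    (h0 : fourierCoeff g 0 = 1) (h : ∀ n ≠ 0, fourierCoeff g n = 0) :
    ∀ᵐ w ∂freqMeasure, g w = 1 := by
  refine ae_eq_of_fourierCoeff_eq hg (memLp_const 1) fun n => ?_
  rw [fourierCoeff_one]
  split_ifs with hn
  · rw [hn, h0]
  · exact h n hn

/-! ### Spectral factorization -/

theorem memℓp_two_neg {φ : ℕ → ℝ} (hφ : Memℓp φ 2) : Memℓp (fun j => -φ j) 2 :=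
  hφ.neg

theorem memLp_phiFun (φ : ℕ → ℝ) : MemLp (phiFun φ) 2 freqMeasure := memLp_causalTransform _

theorem memLp_psiFun (ψ : ℕ → ℝ) : MemLp (psiFun ψ) 2 freqMeasure := memLp_causalTransform _

theorem fourierCoeff_phiFun {φ : ℕ → ℝ} (hφ : Memℓp φ 2) (n : ℤ) :
    fourierCoeff (phiFun φ) n = if 0 ≤ n then -(φ n.toNat : ℂ) else 0 := by
  rw [phiFun, fourierCoeff_causalTransform (memℓp_two_neg hφ)]
  push_cast
  rfl

theorem fourierCoeff_phiFun_of_neg {φ : ℕ → ℝ} (hφ : Memℓp φ 2) {n : ℤ} (hn : n < 0) :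
    fourierCoeff (phiFun φ) n = 0 := by
  rw [fourierCoeff_phiFun hφ, if_neg hn.not_ge]

theorem fourierCoeff_phiFun_zero {φ : ℕ → ℝ} (hφ : Memℓp φ 2) (hφ0 : φ 0 = -1) :
    fourierCoeff (phiFun φ) 0 = 1 := by
  simp [fourierCoeff_phiFun hφ, hφ0]

theorem fourierCoeff_psiFun_of_neg {ψ : ℕ → ℝ} (hψ : Memℓp ψ 2) {n : ℤ} (hn : n < 0) :
    fourierCoeff (psiFun ψ) n = 0 :=
  fourierCoeff_causalTransform_of_neg hψ hn

theorem fourierCoeff_psiFun_zero {ψ : ℕ → ℝ} (hψ : Memℓp ψ 2) (hψ0 : ψ 0 = 1) :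
    fourierCoeff (psiFun ψ) 0 = 1 := by
  simp [psiFun, fourierCoeff_causalTransform hψ, hψ0]

theorem eq_of_causalTransform_ae_eq {a b : ℕ → ℝ} (ha : Memℓp a 2) (hb : Memℓp b 2)
    (h : causalTransform a =ᵐ[freqMeasure] causalTransform b) : a = b := by
  ext n
  have := congrFun (fourierCoeff_congr_ae h) n
  rw [fourierCoeff_causalTransform_nat ha, fourierCoeff_causalTransform_nat hb] at this
  exact_mod_cast this

theorem memLp_top_ofReal_of_bounded {f : AddCircle (2 * π) → ℝ}
    (hf : MemLp (fun w => (f w : ℂ)) 2 freqMeasure) (hfb : IsBoundedAwayFromZeroAndInfinity f) :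
    MemLp (fun w => (f w : ℂ)) ∞ freqMeasure := by
  obtain ⟨m, M, hm, hb⟩ := hfb
  refine memLp_top_of_bound hf.1 M ?_
  filter_upwards [hb] with w hw
  rw [Complex.norm_real, Real.norm_of_nonneg (hm.le.trans hw.1)]
  exact hw.2

theorem IsBoundedAwayFromZeroAndInfinity.ae_pos {f : AddCircle (2 * π) → ℝ}
    (hfb : IsBoundedAwayFromZeroAndInfinity f) : ∀ᵐ w ∂freqMeasure, 0 < f w := by
  obtain ⟨m, M, hm, hb⟩ := hfb
  filter_upwards [hb] with w hw using hm.trans_le hw.1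

/-- If `f φ` has no Fourier coefficients of positive index, then `f |φ|²` is constant. -/
theorem exists_mul_norm_sq_phiFun_eq {f : AddCircle (2 * π) → ℝ}
    (hf : MemLp (fun w => (f w : ℂ)) 2 freqMeasure) (hfb : IsBoundedAwayFromZeroAndInfinity f)
    {φ : ℕ → ℝ} (hφ : Memℓp φ 2) (hφ0 : φ 0 = -1)
    (horth : ∀ n > 0, fourierCoeff (fun w => (f w : ℂ) * phiFun φ w) n = 0) :
    ∃ K : ℝ, 0 < K ∧ ∀ᵐ w ∂freqMeasure, f w * ‖phiFun φ w‖ ^ 2 = K := by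
  have hΦ := memLp_phiFun φ
  have hF := memLp_two_mul_of_top (memLp_top_ofReal_of_bounded hf hfb) hΦ
  set g : AddCircle (2 * π) → ℝ := fun w => f w * ‖phiFun φ w‖ ^ 2 with hg
  -- Neither factor on the right has positive frequencies, so neither does the product.
  have hgeq (w) : (g w : ℂ) = conj (phiFun φ w) * ((f w : ℂ) * phiFun φ w) := by
    rw [hg]
    push_cast
    rw [← Complex.mul_conj']
    ring
  have hgi : Integrable g freqMeasure := by
    have : Integrable (fun w => (g w : ℂ)) freqMeasure := by
      simp only [hgeq]
      exact (memLp_conj hΦ).integrable_mul hF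
    simpa using this.re
  have hg0 : ∀ᵐ w ∂freqMeasure, 0 ≤ g w := by
    filter_upwards [hfb.ae_pos] with w hw
    positivity
  have hpos (n : ℤ) (hn : 0 < n) : fourierCoeff (fun w => (g w : ℂ)) n = 0 := by
    simp only [hgeq]
    refine fourierCoeff_mul_eq_zero (memLp_conj hΦ) hF fun k => ?_
    rcases lt_or_ge 0 k with hk | hk
    · exact .inr (horth k hk)
    · left
      rw [fourierCoeff_conj, fourierCoeff_phiFun_of_neg hφ (by omega), map_zero]
  have hne (n : ℤ) (hn : n ≠ 0) : fourierCoeff (fun w => (g w : ℂ)) n = 0 := by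
    rcases hn.lt_or_gt with hn | hn
    · have h1 := fourierCoeff_conj (fun w => (g w : ℂ)) n
      simp only [Complex.conj_ofReal] at h1
      rw [h1, hpos _ (by omega), map_zero]
    · exact hpos n hn
  have hK := ae_eq_const_of_fourierCoeff_eq_zero hgi hg0 hne
  refine ⟨_, (integral_nonneg_of_ae hg0).lt_of_ne fun h0 => ?_, hK⟩
  -- A vanishing constant would give φ = 0, against its zeroth coefficient 1.
  have hz : phiFun φ =ᵐ[freqMeasure] fun _ => 0 := by
    filter_upwards [hK, hfb.ae_pos] with w hw hw0
    rw [← h0, hg] at hw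
    simpa [hw0.ne'] using hw
  have h1 := congrFun (fourierCoeff_congr_ae hz) 0
  rw [fourierCoeff_phiFun_zero hφ hφ0] at h1
  simp [fourierCoeff] at h1

theorem exists_isSpectralFactorization {c : ℤ → ℝ} {f : AddCircle (2 * π) → ℝ}
    (hf : IsSpectralDensity c f) (hfb : IsBoundedAwayFromZeroAndInfinity f)
    {φ : ℕ → ℝ} (hφ : Memℓp φ 2) (hφ0 : φ 0 = -1)
    (horth : ∀ n > 0, fourierCoeff (fun w => (f w : ℂ) * phiFun φ w) n = 0) :
    ∃ σ ψ, IsSpectralFactorization f σ φ ψ := by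
  obtain ⟨K, hK0, hK⟩ := exists_mul_norm_sq_phiFun_eq hf.memLp hfb hφ hφ0 horth
  have hΦ := memLp_phiFun φ
  have hF := memLp_two_mul_of_top (memLp_top_ofReal_of_bounded hf.memLp hfb) hΦ
  -- From f|φ|² = K this is the inverse of φ; the conjugation turns the absence of positive
  -- frequencies in fφ into causality.
  set Ψ : AddCircle (2 * π) → ℂ := fun w => (K : ℂ)⁻¹ * conj ((f w : ℂ) * phiFun φ w) with hΨdef
  have hΨ : MemLp Ψ 2 freqMeasure := (memLp_conj hF).const_mul _
  have hΨc (n : ℤ) : fourierCoeff Ψ n =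
      (K : ℂ)⁻¹ * conj (fourierCoeff (fun w => (f w : ℂ) * phiFun φ w) (-n)) := by
    rw [← fourierCoeff_conj]
    exact fourierCoeff.const_mul _ _ _
  -- The coefficients of f and φ are real, hence so is their convolution.
  have hreal (n : ℤ) : conj (fourierCoeff Ψ n) = fourierCoeff Ψ n := by
    have h1 := hasSum_fourierCoeff_mul hf.memLp hΦ (-n)
    have h2 : conj (fourierCoeff (fun w => (f w : ℂ) * phiFun φ w) (-n)) =
        fourierCoeff (fun w => (f w : ℂ) * phiFun φ w) (-n) := by
      refine (Complex.hasSum_conj'.2 h1).unique ?_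
      convert h1 using 2 with k
      rw [map_mul, hf.fourierCoeff_eq, fourierCoeff_phiFun hφ]
      split_ifs <;> simp
    rw [hΨc, h2, map_mul, h2, map_inv₀, Complex.conj_ofReal]
  have hneg (n : ℤ) (hn : n < 0) : fourierCoeff Ψ n = 0 := by
    rw [hΨc, horth _ (by omega), map_zero, mul_zero]
  have hre (n : ℤ) : ((fourierCoeff Ψ n).re : ℂ) = fourierCoeff Ψ n :=
    Complex.conj_eq_iff_re.1 (hreal n)
  have hmul : ∀ᵐ w ∂freqMeasure, phiFun φ w * Ψ w = 1 := by
    filter_upwards [hK] with w hw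
    have : phiFun φ w * conj (phiFun φ w) * f w = K := by
      rw [Complex.mul_conj', ← hw]
      push_cast
      ring
    rw [hΨdef]
    simp only [map_mul, Complex.conj_ofReal]
    have hK' : (K : ℂ) ≠ 0 := by exact_mod_cast hK0.ne'
    field_simp
    linear_combination this
  let ψ : ℕ → ℝ := fun n => (fourierCoeff Ψ n).re
  have hψ : Memℓp ψ 2 := by
    have h1 := memℓp_fourierCoeff hΨ
    rw [memℓp_two_iff] at h1 ⊢
    have h2 := h1.comp_injective (Nat.cast_injective (R := ℤ))
    refine h2.of_nonneg_of_le (fun _ => by positivity) fun n => ?_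
    exact pow_le_pow_left₀ (norm_nonneg _) (Complex.abs_re_le_norm _) 2
  have hΨψ : psiFun ψ =ᵐ[freqMeasure] Ψ := by
    refine ae_eq_of_fourierCoeff_eq (memLp_psiFun ψ) hΨ fun n => ?_
    rw [psiFun, fourierCoeff_causalTransform hψ]
    split_ifs with hn
    · rw [hre, Int.toNat_of_nonneg hn]
    · rw [hneg n (not_le.1 hn)]
  have hψ0 : ψ 0 = 1 := by
    have h1 := fourierCoeff_mul_zero hΦ hΨ (fun n hn => fourierCoeff_phiFun_of_neg hφ hn) hneg
    rw [fourierCoeff_congr_ae hmul, fourierCoeff_one, if_pos rfl,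
      fourierCoeff_phiFun_zero hφ hφ0, one_mul, ← hre 0] at h1
    exact_mod_cast h1.symm
  have hmul' : ∀ᵐ w ∂freqMeasure, phiFun φ w * psiFun ψ w = 1 := by
    filter_upwards [hmul, hΨψ] with w h1 h2
    rw [h2, h1]
  have hΦ2 : ∀ᵐ w ∂freqMeasure, f w = √K ^ 2 * (‖phiFun φ w‖ ^ 2)⁻¹ := by
    filter_upwards [hK, hmul] with w h1 h2
    have : ‖phiFun φ w‖ ≠ 0 := norm_ne_zero_iff.2 (left_ne_zero_of_mul_eq_one h2)
    rw [Real.sq_sqrt hK0.le, ← h1]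
    field_simp
  refine ⟨√K, ψ, Real.sqrt_pos.2 hK0, hφ0, hψ0, hφ, hψ, hmul', ?_, hΦ2⟩
  filter_upwards [hΦ2, hmul'] with w h1 h2
  rw [h1, eq_inv_of_mul_eq_one_right h2, norm_inv, inv_pow]

namespace IsSpectralFactorization

variable {f : AddCircle (2 * π) → ℝ} {σ : ℝ} {φ ψ : ℕ → ℝ}

/-- Bounds on f bound the factors, |ψ|² ≤ M/σ² and |φ|² ≤ σ²/m, which makes them multipliers on
`L²`. -/
theorem memLp_top_psiFun (h : IsSpectralFactorization f σ φ ψ)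
    (hfb : IsBoundedAwayFromZeroAndInfinity f) : MemLp (psiFun ψ) ∞ freqMeasure := by
  obtain ⟨m, M, hm, hb⟩ := hfb
  refine memLp_top_of_norm_sq_le (C := M / σ ^ 2) (memLp_psiFun ψ).1 ?_
  filter_upwards [hb, h.eq_psi] with w h1 h2
  have := h.sigma_pos
  rw [le_div_iff₀ (by positivity), mul_comm, ← h2]
  exact h1.2

theorem memLp_top_phiFun (h : IsSpectralFactorization f σ φ ψ)
    (hfb : IsBoundedAwayFromZeroAndInfinity f) : MemLp (phiFun φ) ∞ freqMeasure := by
  obtain ⟨m, M, hm, hb⟩ := hfb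
  refine memLp_top_of_norm_sq_le (C := σ ^ 2 / m) (memLp_phiFun φ).1 ?_
  filter_upwards [hb, h.eq_phi, h.mul_eq_one] with w h1 h2 h3
  have h4 : ‖phiFun φ w‖ ≠ 0 := norm_ne_zero_iff.2 (left_ne_zero_of_mul_eq_one h3)
  rw [le_div_iff₀ hm]
  calc ‖phiFun φ w‖ ^ 2 * m ≤ ‖phiFun φ w‖ ^ 2 * f w :=
        mul_le_mul_of_nonneg_left h1.1 (by positivity)
    _ = σ ^ 2 := by
        rw [h2]
        field_simp

theorem unique (hfb : IsBoundedAwayFromZeroAndInfinity f) {σ' : ℝ} {φ' ψ' : ℕ → ℝ}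
    (h : IsSpectralFactorization f σ φ ψ) (h' : IsSpectralFactorization f σ' φ' ψ') :
    σ' = σ ∧ φ' = φ ∧ ψ' = ψ := by
  have hσ := h.sigma_pos
  have hσ' := h'.sigma_pos
  have hq := memLp_two_mul_of_top (h'.memLp_top_psiFun hfb) (memLp_phiFun φ)
  have hr := memLp_two_mul_of_top (h.memLp_top_psiFun hfb) (memLp_phiFun φ')
  have hqneg (n : ℤ) (hn : n < 0) := fourierCoeff_mul_of_neg (memLp_psiFun ψ') (memLp_phiFun φ)
    (fun n hn => fourierCoeff_psiFun_of_neg h'.psi_memlp hn)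
    (fun n hn => fourierCoeff_phiFun_of_neg h.phi_memlp hn) hn
  have hrneg (n : ℤ) (hn : n < 0) := fourierCoeff_mul_of_neg (memLp_psiFun ψ) (memLp_phiFun φ')
    (fun n hn => fourierCoeff_psiFun_of_neg h.psi_memlp hn)
    (fun n hn => fourierCoeff_phiFun_of_neg h'.phi_memlp hn) hn
  have hq0 : fourierCoeff (fun w => psiFun ψ' w * phiFun φ w) 0 = 1 := by
    rw [fourierCoeff_mul_zero (memLp_psiFun ψ') (memLp_phiFun φ)
      (fun n hn => fourierCoeff_psiFun_of_neg h'.psi_memlp hn)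
      (fun n hn => fourierCoeff_phiFun_of_neg h.phi_memlp hn),
      fourierCoeff_psiFun_zero h'.psi_memlp h'.psi_zero,
      fourierCoeff_phiFun_zero h.phi_memlp h.phi_zero, one_mul]
  -- With q = ψ'φ, the product of q and ψφ' is 1 and |q|² = σ²/σ'². Thus the conjugate of q is a
  -- multiple of the causal function ψφ', and q has no positive frequencies.
  have hconj : (fun w => conj (psiFun ψ' w * phiFun φ w)) =ᵐ[freqMeasure]
      fun w => ((σ ^ 2 / σ' ^ 2 : ℝ) : ℂ) * (psiFun ψ w * phiFun φ' w) := by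
    filter_upwards [h.mul_eq_one, h'.mul_eq_one, h.eq_phi, h'.eq_psi] with w h1 h2 h3 h4
    have hne : phiFun φ w ≠ 0 := left_ne_zero_of_mul_eq_one h1
    have hne' : psiFun ψ' w ≠ 0 := right_ne_zero_of_mul_eq_one h2
    have hprod : (psiFun ψ' w * phiFun φ w) * (psiFun ψ w * phiFun φ' w) = 1 := by
      linear_combination phiFun φ' w * psiFun ψ' w * h1 + h2
    have hn : ‖psiFun ψ' w‖ ^ 2 * ‖phiFun φ w‖ ^ 2 = σ ^ 2 / σ' ^ 2 := by
      have : ‖phiFun φ w‖ ≠ 0 := norm_ne_zero_iff.2 hne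
      rw [h3] at h4
      field_simp at h4 ⊢
      linear_combination -h4
    have hmc : (psiFun ψ' w * phiFun φ w) * conj (psiFun ψ' w * phiFun φ w) =
        ((σ ^ 2 / σ' ^ 2 : ℝ) : ℂ) := by
      rw [Complex.mul_conj', norm_mul, ← hn]
      push_cast
      ring
    refine mul_left_cancel₀ (mul_ne_zero hne' hne) ?_
    rw [hmc]
    linear_combination -((σ ^ 2 / σ' ^ 2 : ℝ) : ℂ) * hprod
  have hqpos (n : ℤ) (hn : 0 < n) : fourierCoeff (fun w => psiFun ψ' w * phiFun φ w) n = 0 := by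
    have h1 := congrFun (fourierCoeff_congr_ae hconj) (-n)
    rw [fourierCoeff_conj, neg_neg, fourierCoeff.const_mul, hrneg _ (by omega), mul_zero] at h1
    simpa using h1
  have hone := ae_eq_one_of_fourierCoeff hq hq0 fun n hn => by
    rcases hn.lt_or_gt with hn | hn
    exacts [hqneg n hn, hqpos n hn]
  have hψ : ψ' = ψ := by
    refine eq_of_causalTransform_ae_eq h'.psi_memlp h.psi_memlp ?_
    filter_upwards [hone, h.mul_eq_one] with w h1 h2
    change psiFun ψ' w = psiFun ψ w
    linear_combination psiFun ψ w * h1 - psiFun ψ' w * h2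
  have hφ : φ' = φ := by
    have : (fun j => -φ' j) = fun j => -φ j := by
      refine eq_of_causalTransform_ae_eq (memℓp_two_neg h'.phi_memlp)
        (memℓp_two_neg h.phi_memlp) ?_
      filter_upwards [hone, h'.mul_eq_one] with w h1 h2
      change phiFun φ' w = phiFun φ w
      linear_combination phiFun φ w * h2 - phiFun φ' w * h1
    ext j
    simpa using congrFun this j
  refine ⟨?_, hφ, hψ⟩
  obtain ⟨w, h1, h2, h3⟩ := (h.eq_psi.and (h'.eq_psi.and h.mul_eq_one)).exists
  have hne : ‖psiFun ψ w‖ ≠ 0 := norm_ne_zero_iff.2 (right_ne_zero_of_mul_eq_one h3)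
  rw [hψ, h1] at h2
  have h4 : σ ^ 2 = σ' ^ 2 := mul_right_cancel₀ (pow_ne_zero 2 hne) h2
  exact ((pow_left_inj₀ hσ.le hσ'.le two_ne_zero).1 h4).symm

end IsSpectralFactorization

/-- The coefficients of the one-step predictor give the spectral factorization. -/
theorem existsUnique_isSpectralFactorization {Ω : Type*} [MeasurableSpace Ω] {P : Measure Ω}
    [IsProbabilityMeasure P] {X : ℤ → Ω → ℝ} (hX : IsWeaklyStationary P X)
    {f : AddCircle (2 * π) → ℝ} (hf : IsSpectralDensity (autocov P X) f)
    (hfb : IsBoundedAwayFromZeroAndInfinity f) :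
    ∃! p : ℝ × (ℕ → ℝ) × (ℕ → ℝ), IsSpectralFactorization f p.1 p.2.1 p.2.2 := by
  obtain ⟨h, hh, -⟩ := existsUnique_projectionExpansion hX hf hfb (hX.memLp 1)
  have hh2 := IsProjectionExpansion.memℓp hX hf hfb hh
  -- The shift φ_{j+1} = h_j with φ_0 = -1 encodes φ = 1 - e^{iω}H, the filter of the prediction
  -- error of X_1.
  let φ : ℕ → ℝ := fun j => Nat.casesOn j (-1) h
  have hφ : Memℓp φ 2 := by
    rw [memℓp_two_iff] at hh2 ⊢
    exact (summable_nat_add_iff 1).1 hh2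
  have hΦ : phiFun φ =ᵐ[freqMeasure] fun w => 1 - fourier 1 w * causalTransform h w := by
    have hm := memLp_fourier_mul (memLp_causalTransform h) 1
    refine ae_eq_of_fourierCoeff_eq (memLp_phiFun φ) ((memLp_const 1).sub hm) fun n => ?_
    have h1 : fourierCoeff (fun w => 1 - fourier 1 w * causalTransform h w) n =
        (if n = 0 then 1 else 0) - fourierCoeff (causalTransform h) (n - 1) := by
      rw [← fourierCoeff_fourier_mul, ← fourierCoeff_one]
      simp only [fourierCoeff, smul_sub]
      exact integral_sub ((integrable_const 1).fourier_smul _)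
        ((integrable_of_memLp_two hm).fourier_smul _)
    rw [h1, fourierCoeff_phiFun hφ, fourierCoeff_causalTransform hh2]
    rcases lt_trichotomy n 0 with hn | rfl | hn
    · rw [if_neg (by omega), if_neg (by omega), if_neg (by omega), sub_zero]
    · simp [φ]
    · obtain ⟨k, rfl⟩ : ∃ k : ℕ, n = k + 1 := ⟨(n - 1).toNat, by omega⟩
      rw [if_pos (by omega), if_neg (by omega), if_pos (by omega), zero_sub]
      have e1 : ((k : ℤ) + 1).toNat = k + 1 := by omega
      have e2 : ((k : ℤ) + 1 - 1).toNat = k := by omega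
      rw [e1, e2]
  -- The n-th coefficient is c(n) minus the (n-1)-st coefficient of fH, which is cov(X_1,
  -- X_{-(n-1)}) = c(n): the prediction error is orthogonal to the past.
  have horth : ∀ n > 0, fourierCoeff (fun w => (f w : ℂ) * phiFun φ w) n = 0 := by
    intro n hn
    have hfm := memLp_two_mul_of_top (memLp_top_ofReal_of_bounded hf.memLp hfb)
      (memLp_causalTransform h)
    have h1 : (fun w => (f w : ℂ) * phiFun φ w) =ᵐ[freqMeasure]
        fun w => (f w : ℂ) - fourier 1 w * ((f w : ℂ) * causalTransform h w) := by
      filter_upwards [hΦ] with w hw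
      rw [hw]
      ring
    have h2 : fourierCoeff
        (fun w => (f w : ℂ) - fourier 1 w * ((f w : ℂ) * causalTransform h w)) n =
        fourierCoeff (fun w => (f w : ℂ)) n -
          fourierCoeff (fun w => (f w : ℂ) * causalTransform h w) (n - 1) := by
      rw [← fourierCoeff_fourier_mul]
      simp only [fourierCoeff, smul_sub]
      exact integral_sub ((integrable_of_memLp_two hf.memLp).fourier_smul _)
        ((integrable_of_memLp_two (memLp_fourier_mul hfm 1)).fourier_smul _)
    obtain ⟨k, rfl⟩ : ∃ k : ℕ, n = k + 1 := ⟨(n - 1).toNat, by omega⟩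
    have h3 : crossCov P (X 1) X k = autocov P X ((k : ℤ) + 1) := by
      have := hX.cov_neg_neg (-1) k
      rwa [neg_neg, sub_neg_eq_add] at this
    rw [fourierCoeff_congr_ae h1, h2, add_sub_cancel_right,
      IsProjectionExpansion.fourierCoeff_mul hX hf hfb hh, hf.fourierCoeff_eq, h3, sub_self]
  obtain ⟨σ, ψ, hfac⟩ := exists_isSpectralFactorization hf hfb hφ rfl horth
  refine ⟨(σ, φ, ψ), hfac, ?_⟩
  rintro ⟨σ', φ', ψ'⟩ h'
  obtain ⟨rfl, rfl, rfl⟩ := hfac.unique hfb h'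
  rfl

/-! ### Causal part and multiplication operators on `L²` of the circle -/

/-- The orthogonal projection of `L²` onto the functions without Fourier coefficients of negative
index. -/
def causalPart : Lp ℂ 2 freqMeasure →L[ℂ] Lp ℂ 2 freqMeasure :=
  (Submodule.span ℂ
    ((fun n : ℤ => (fourierLp 2 n : Lp ℂ 2 freqMeasure)) '' Set.Iio 0))ᗮ.starProjection

theorem fourierCoeff_eq_inner (g : Lp ℂ 2 freqMeasure) (n : ℤ) :
    fourierCoeff g n = inner ℂ (fourierLp 2 n : Lp ℂ 2 freqMeasure) g := by
  rw [← fourierBasis_repr, HilbertBasis.repr_apply_apply, coe_fourierBasis]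

theorem fourierCoeff_causalPart (g : Lp ℂ 2 freqMeasure) (n : ℤ) :
    fourierCoeff (causalPart g) n = if 0 ≤ n then fourierCoeff g n else 0 := by
  rw [fourierCoeff_eq_inner, fourierCoeff_eq_inner, causalPart]
  split_ifs with hn
  -- The projection is self-adjoint and, for n ≥ 0, fixes `e^{inω}`, which is orthogonal to all
  -- negative frequencies.
  · rw [← Submodule.inner_starProjection_left_eq_right, Submodule.starProjection_eq_self_iff.2]
    rw [Submodule.mem_orthogonal]
    intro u hu
    induction hu using Submodule.span_induction with
    | mem u hu =>
      obtain ⟨k, hk, rfl⟩ := hu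
      exact orthonormal_fourier.2 (by simp only [Set.mem_Iio] at hk; omega)
    | zero => exact inner_zero_left _
    | add u v _ _ hu hv => rw [inner_add_left, hu, hv, add_zero]
    | smul a u _ hu => rw [inner_smul_left, hu, mul_zero]
  · exact (Submodule.mem_orthogonal _ _).1 (Submodule.starProjection_apply_mem _ g) _
      (Submodule.subset_span ⟨n, not_le.1 hn, rfl⟩)

/-- Multiplication by an essentially bounded function as an operator on `L²`. -/
def mulLp {g : AddCircle (2 * π) → ℂ} (hg : MemLp g ∞ freqMeasure) :
    Lp ℂ 2 freqMeasure →L[ℂ] Lp ℂ 2 freqMeasure :=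
  (ContinuousLinearMap.mul ℂ ℂ).holderL freqMeasure ∞ 2 2 (hg.toLp g)

theorem coeFn_mulLp {g : AddCircle (2 * π) → ℂ} (hg : MemLp g ∞ freqMeasure)
    (F : Lp ℂ 2 freqMeasure) : mulLp hg F =ᵐ[freqMeasure] fun w => g w * F w := by
  have h : mulLp hg F = (ContinuousLinearMap.mul ℂ ℂ).holder 2 (hg.toLp g) F := rfl
  rw [h]
  filter_upwards [(ContinuousLinearMap.mul ℂ ℂ).coeFn_holder (r := 2) (hg.toLp g) F,
    hg.coeFn_toLp] with w h1 h2
  rw [h1, h2]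
  rfl

theorem hasSumL2_of_hasSum {F : ℕ → Lp ℂ 2 freqMeasure} {G : Lp ℂ 2 freqMeasure}
    (h : HasSum F G) {u : ℕ → AddCircle (2 * π) → ℂ} {g : AddCircle (2 * π) → ℂ}
    (hu : ∀ l, F l =ᵐ[freqMeasure] u l) (hg : G =ᵐ[freqMeasure] g) : HasSumL2 u g := by
  refine ⟨fun l => (memLp_congr_ae (hu l)).1 (Lp.memLp _), (memLp_congr_ae hg).1 (Lp.memLp _), ?_⟩
  have h1 : Tendsto (fun s : Finset ℕ => ‖∑ l ∈ s, F l - G‖ₑ) atTop (𝓝 0) := by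
    rw [← tendsto_iff_enorm_sub_tendsto_zero]
    exact h
  refine h1.congr fun s => ?_
  rw [Lp.enorm_def]
  refine eLpNorm_congr_ae ?_
  filter_upwards [Lp.coeFn_sub (∑ l ∈ s, F l) G, Lp.coeFn_finsetSum s F, hg,
    ae_all_iff.2 hu] with w h1 h2 h3 h4
  rw [h1, Pi.sub_apply, h2, h3, Finset.sum_apply]
  simp only [h4]

/-! ### The transfer function of the projection -/

/-- The convolution sees `h` only where the shifted coefficients of `g` are nonzero. This allows fH
to be replaced by its causal truncation. -/
theorem fourierCoeff_mul_congr {g h h' : AddCircle (2 * π) → ℂ} (hg : MemLp g 2 freqMeasure)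
    (hh : MemLp h 2 freqMeasure) (hh' : MemLp h' 2 freqMeasure) {n : ℤ}
    (H : ∀ k, fourierCoeff g (n - k) = 0 ∨ fourierCoeff h k = fourierCoeff h' k) :
    fourierCoeff (fun w => g w * h w) n = fourierCoeff (fun w => g w * h' w) n := by
  refine (hasSum_fourierCoeff_mul hg hh n).unique ?_
  convert hasSum_fourierCoeff_mul hg hh' n using 2 with k
  rcases H k with h0 | h0 <;> simp [h0]

/-- `e^{iℓω} - ∑_{s=1}^ℓ φ_s e^{i(ℓ-s)ω}`. -/
def phiHead (φ : ℕ → ℝ) (l : ℕ) (w : AddCircle (2 * π)) : ℂ :=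
  fourier (l : ℤ) w - ∑ s ∈ Finset.Icc 1 l, (φ s : ℂ) * fourier ((l : ℤ) - (s : ℤ)) w

theorem memLp_phiHead (φ : ℕ → ℝ) (l : ℕ) : MemLp (phiHead φ l) 2 freqMeasure :=
  (memLp_two_fourier _).sub
    (memLp_finsetSum _ fun s _ => (memLp_two_fourier ((l : ℤ) - (s : ℤ))).const_mul (φ s : ℂ))

/-- By the convention φ_0 = -1, the leading exponential is the missing term s = 0 of the sum. -/
theorem fourierCoeff_phiHead {φ : ℕ → ℝ} (hφ0 : φ 0 = -1) (l : ℕ) (n : ℤ) :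
    fourierCoeff (phiHead φ l) n =
      if 0 ≤ n ∧ n ≤ l then -(φ ((l : ℤ) - n).toNat : ℂ) else 0 := by
  have hi (k : ℤ) : Integrable (fun w : AddCircle (2 * π) => fourier k w) freqMeasure :=
    integrable_of_memLp_two (memLp_two_fourier k)
  have hs (s : ℕ) : Integrable
      (fun w : AddCircle (2 * π) => (φ s : ℂ) * fourier ((l : ℤ) - (s : ℤ)) w) freqMeasure :=
    (hi _).const_mul _
  have h1 : fourierCoeff (phiHead φ l) n = (if n = l then 1 else 0) -
      ∑ s ∈ Finset.Icc 1 l, (φ s : ℂ) * (if n = (l : ℤ) - s then 1 else 0) := by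
    rw [← fourierCoeff_fourier_apply]
    simp only [← fourierCoeff_fourier_apply, ← fourierCoeff.const_mul]
    rw [← Finset.sum_apply, ← fourierCoeff.sum _ _ fun s _ => hs s]
    simp only [fourierCoeff, phiHead]
    rw [← integral_sub ((hi _).fourier_smul _)
      (Integrable.fourier_smul (integrable_finsetSum' _ fun s _ => hs s) _)]
    simp only [Finset.sum_apply, smul_sub]
  rw [h1]
  split_ifs with hln hn hn
  · rw [Finset.sum_eq_zero fun s hs => ?_]
    · simp [hln, hφ0]
    · have := (Finset.mem_Icc.1 hs).1
      rw [if_neg (by omega), mul_zero]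
  · omega
  · rw [Finset.sum_eq_single_of_mem ((l : ℤ) - n).toNat (Finset.mem_Icc.2 (by omega))]
    · rw [if_pos (by omega)]
      ring
    · intro s _ hs
      rw [if_neg (by omega), mul_zero]
  · rw [Finset.sum_eq_zero fun s hs => ?_, sub_zero]
    have := Finset.mem_Icc.1 hs
    rw [if_neg (by omega), mul_zero]

theorem memℓp_phiTail {φ : ℕ → ℝ} (hφ : Memℓp φ 2) (l : ℕ) :
    Memℓp (fun s => if s = 0 then 0 else φ (l + s)) 2 := by
  rw [memℓp_two_iff] at hφ ⊢
  have h := hφ.comp_injective (add_right_injective l)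
  refine h.of_nonneg_of_le (fun _ => by positivity) fun s => ?_
  split_ifs
  · simp only [norm_zero, ne_eq, OfNat.ofNat_ne_zero, not_false_eq_true, zero_pow]
    exact sq_nonneg _
  · exact le_rfl

/-- Splitting `e^{iℓω} φ(ω)^*` into its causal and its strictly anticausal part. -/
theorem phiHead_ae_eq {φ : ℕ → ℝ} (hφ : Memℓp φ 2) (hφ0 : φ 0 = -1) (l : ℕ) :
    phiHead φ l =ᵐ[freqMeasure]
      fun w => fourier (l : ℤ) w * conj (phiFun φ w) + conj (phiTail φ l w) := by
  have h1 := memLp_fourier_mul (memLp_conj (memLp_phiFun φ)) l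
  have h2 := memLp_conj (memLp_causalTransform (fun s => if s = 0 then 0 else φ (l + s)))
  refine ae_eq_of_fourierCoeff_eq (memLp_phiHead φ l) (h1.add h2) fun n => ?_
  have h3 := congrFun (fourierCoeff.add (integrable_of_memLp_two h1)
    (integrable_of_memLp_two h2)) n
  rw [Pi.add_apply, fourierCoeff_fourier_mul, fourierCoeff_conj, fourierCoeff_conj,
    fourierCoeff_causalTransform (memℓp_phiTail hφ l), fourierCoeff_phiFun hφ] at h3
  refine Eq.trans ?_ h3.symm
  rw [fourierCoeff_phiHead hφ0]
  rcases lt_trichotomy n 0 with hn | rfl | hn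
  · rw [if_neg (by omega), if_pos (by omega), if_pos (by omega), if_neg (by omega),
      show (-(n - (l : ℤ))).toNat = l + (-n).toNat by omega]
    simp
  · simp
  · rw [if_neg (show ¬ 0 ≤ -n by omega), map_zero, add_zero]
    by_cases hl : n ≤ l
    · rw [if_pos (by omega), if_pos (by omega), neg_sub]
      simp
    · rw [if_neg (by omega), if_neg (by omega), map_zero]

/-- The unconditional convergence of both final series stems from this one, through bounded
operators applied termwise. -/
theorem hasSum_causalTransform {a : ℕ → ℝ} (ha : Memℓp a 2) :
    HasSum (fun l : ℕ => (a l : ℂ) • (fourierLp 2 (l : ℤ) : Lp ℂ 2 freqMeasure))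
      ((memLp_causalTransform a).toLp (causalTransform a)) := by
  have h := (fourierBasis (T := 2 * π)).hasSum_repr
    ((memLp_causalTransform a).toLp (causalTransform a))
  simp only [fourierBasis_repr, fourierCoeff_toLp_eq, coe_fourierBasis] at h
  rw [← Function.Injective.hasSum_iff (g := ((↑) : ℕ → ℤ)) Nat.cast_injective] at h
  · refine h.congr_fun fun l => ?_
    simp only [Function.comp_apply, fourierCoeff_causalTransform_nat ha]
  · intro k hk
    have hk0 : k < 0 := by
      by_contra hk0
      exact hk ⟨k.toNat, Int.toNat_of_nonneg (not_lt.1 hk0)⟩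
    rw [fourierCoeff_causalTransform_of_neg ha hk0, zero_smul]

section

variable {f : AddCircle (2 * π) → ℝ} {σ : ℝ} {φ ψ : ℕ → ℝ} {h c : ℕ → ℝ}

/-- As f is bounded, fH lies in `L²`, and `c` is part of its coefficient sequence. -/
theorem memℓp_of_fourierCoeff_mul (hf : MemLp (fun w => (f w : ℂ)) 2 freqMeasure)
    (hfb : IsBoundedAwayFromZeroAndInfinity f)
    (hc : ∀ l : ℕ, fourierCoeff (fun w => (f w : ℂ) * causalTransform h w) l = c l) :
    Memℓp c 2 := by
  have h1 := memℓp_fourierCoeff (memLp_two_mul_of_top (memLp_top_ofReal_of_bounded hf hfb)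
    (memLp_causalTransform h))
  rw [memℓp_two_iff] at h1 ⊢
  have h2 := h1.comp_injective (Nat.cast_injective (R := ℤ))
  refine h2.congr fun l => ?_
  simp [hc]

/-- If `f h` has the causal Fourier coefficients `c`, then the expansion of `c` in the functions
`phiHead φ l` is `σ² h ψ`. -/
theorem IsSpectralFactorization.hasSum_causalPart (hfac : IsSpectralFactorization f σ φ ψ)
    (hf : MemLp (fun w => (f w : ℂ)) 2 freqMeasure)
    (hfb : IsBoundedAwayFromZeroAndInfinity f) (hh : Memℓp h 2)
    (hc : ∀ l : ℕ, fourierCoeff (fun w => (f w : ℂ) * causalTransform h w) l = c l) :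
    ∃ (F : ℕ → Lp ℂ 2 freqMeasure) (G : Lp ℂ 2 freqMeasure), HasSum F G ∧
      (∀ l, F l =ᵐ[freqMeasure] fun w => (c l : ℂ) * phiHead φ l w) ∧
      G =ᵐ[freqMeasure] fun w => (σ : ℂ) ^ 2 * (psiFun ψ w * causalTransform h w) := by
  have hc2 := memℓp_of_fourierCoeff_mul hf hfb hc
  have hΦ := memLp_conj (hfac.memLp_top_phiFun hfb)
  have hΦ2 := two_memLp_of_top hΦ
  have hH := memLp_causalTransform h
  have hfH := memLp_two_mul_of_top (memLp_top_ofReal_of_bounded hf hfb) hH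
  have hΨH := memLp_two_mul_of_top (hfac.memLp_top_psiFun hfb) hH
  -- Multiplication by φ^* followed by the causal part sends `e^{iℓω}` to `phiHead φ ℓ`.
  have hsum := (hasSum_causalTransform hc2).mapL (causalPart ∘L mulLp hΦ)
  refine ⟨_, _, hsum, fun l => ?_, ?_⟩
  · have h1 : (causalPart ∘L mulLp hΦ) (fourierLp 2 (l : ℤ)) =ᵐ[freqMeasure] phiHead φ l := by
      refine ae_eq_of_fourierCoeff_eq (Lp.memLp _) (memLp_phiHead φ l) fun n => ?_
      have h2 : mulLp hΦ (fourierLp 2 (l : ℤ)) =ᵐ[freqMeasure]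
          fun w => fourier (l : ℤ) w * conj (phiFun φ w) := by
        filter_upwards [coeFn_mulLp hΦ (fourierLp 2 (l : ℤ)), coeFn_fourierLp 2 (l : ℤ)]
          with w h3 h4
        rw [h3, h4, mul_comm]
      rw [ContinuousLinearMap.comp_apply, fourierCoeff_causalPart, fourierCoeff_congr_ae h2,
        fourierCoeff_fourier_mul, fourierCoeff_conj, fourierCoeff_phiHead hfac.phi_zero,
        fourierCoeff_phiFun hfac.phi_memlp, neg_sub]
      by_cases hn : 0 ≤ n
      · by_cases hl : n ≤ l
        · rw [if_pos hn, if_pos (by omega), if_pos ⟨hn, hl⟩]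
          simp
        · rw [if_pos hn, if_neg (by omega), if_neg (by omega), map_zero]
      · rw [if_neg hn, if_neg (by omega)]
    rw [map_smul]
    filter_upwards [Lp.coeFn_smul (c l : ℂ) ((causalPart ∘L mulLp hΦ) (fourierLp 2 (l : ℤ))), h1]
      with w h3 h4
    rw [h3, Pi.smul_apply, h4, smul_eq_mul]
  · refine ae_eq_of_fourierCoeff_eq (Lp.memLp _) (hΨH.const_mul _) fun n => ?_
    rw [ContinuousLinearMap.comp_apply, fourierCoeff_causalPart]
    split_ifs with hn
    · have h1 : mulLp hΦ ((memLp_causalTransform c).toLp (causalTransform c)) =ᵐ[freqMeasure]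
          fun w => conj (phiFun φ w) * causalTransform c w := by
        filter_upwards [coeFn_mulLp hΦ ((memLp_causalTransform c).toLp (causalTransform c)),
          (memLp_causalTransform c).coeFn_toLp] with w h2 h3
        rw [h2, h3]
      have h2 : (fun w => (σ : ℂ) ^ 2 * (psiFun ψ w * causalTransform h w)) =ᵐ[freqMeasure]
          fun w => conj (phiFun φ w) * ((f w : ℂ) * causalTransform h w) := by
        filter_upwards [hfac.eq_psi, hfac.mul_eq_one] with w h3 h4
        have h5 : conj (phiFun φ w) * conj (psiFun ψ w) = 1 := by
          rw [← map_mul, h4, map_one]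
        rw [h3]
        push_cast
        rw [← Complex.mul_conj']
        linear_combination -(σ : ℂ) ^ 2 * psiFun ψ w * causalTransform h w * h5
      rw [fourierCoeff_congr_ae h1, fourierCoeff_congr_ae h2]
      -- The transform of `c` and fH agree at k ≥ 0; for k < 0 ≤ n the index n - k is positive,
      -- where φ^* has no coefficient.
      refine fourierCoeff_mul_congr hΦ2 (memLp_causalTransform c) hfH fun k => ?_
      rcases lt_or_ge k 0 with hk | hk
      · left
        rw [fourierCoeff_conj, fourierCoeff_phiFun_of_neg hfac.phi_memlp (by omega), map_zero]
      · right
        lift k to ℕ using hk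
        rw [fourierCoeff_causalTransform_nat hc2, hc]
    · rw [fourierCoeff.const_mul, fourierCoeff_mul_of_neg (memLp_psiFun ψ) hH
        (fun n hn => fourierCoeff_psiFun_of_neg hfac.psi_memlp hn)
        (fun n hn => fourierCoeff_causalTransform_of_neg hh hn) (not_le.1 hn), mul_zero]

end

end

theorem theorem1 {Ω : Type*} [MeasurableSpace Ω] (P : Measure Ω) [IsProbabilityMeasure P]
    (X : ℤ → Ω → ℝ) (hX : IsWeaklyStationary P X)
    (f : AddCircle (2 * π) → ℝ) (hf : IsSpectralDensity (autocov P X) f)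
    (hfb : IsBoundedAwayFromZeroAndInfinity f)
    (Y : Ω → ℝ) (hY : MemLp Y 2 P) :
    -- the spectral factorization exists and is unique
    (∃! p : ℝ × (ℕ → ℝ) × (ℕ → ℝ), IsSpectralFactorization f p.1 p.2.1 p.2.2) ∧
    -- the expansion of the projection exists and is unique
    (∃! h : ℕ → ℝ, IsProjectionExpansion P X hX.memLp Y hY h) ∧
    ∀ (σ : ℝ) (φ ψ : ℕ → ℝ), IsSpectralFactorization f σ φ ψ →
    ∀ h : ℕ → ℝ, IsProjectionExpansion P X hX.memLp Y hY h →
      Memℓp h 2 ∧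
      Memℓp (crossCov P Y X) 2 ∧
      (∃ G : AddCircle (2 * π) → ℂ,
        HasSumL2 (fun l w => (crossCov P Y X l : ℂ) *
          (fourier (l : ℤ) w + conj (psiFun ψ w) * conj (phiTail φ l w))) G ∧
        ∀ᵐ w ∂freqMeasure,
          causalTransform h w = G w / (f w : ℂ)) ∧
      (∃ G : AddCircle (2 * π) → ℂ,
        HasSumL2 (fun l w => (crossCov P Y X l : ℂ) *
          (fourier (l : ℤ) w -
            ∑ s ∈ Finset.Icc 1 l, (φ s : ℂ) * fourier ((l : ℤ) - (s : ℤ)) w)) G ∧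
        ∀ᵐ w ∂freqMeasure,
          causalTransform h w = ((σ : ℂ) ^ 2)⁻¹ * phiFun φ w * G w) := by
  refine ⟨existsUnique_isSpectralFactorization hX hf hfb,
    existsUnique_projectionExpansion hX hf hfb hY, fun σ φ ψ hfac h hh => ?_⟩
  have hh2 := IsProjectionExpansion.memℓp hX hf hfb hh
  have hc := IsProjectionExpansion.fourierCoeff_mul hX hf hfb hh
  obtain ⟨F, G, hsum, hF, hG⟩ := hfac.hasSum_causalPart hf.memLp hfb hh2 hc
  have hΨ := memLp_conj (hfac.memLp_top_psiFun hfb)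
  -- The first series is ψ^* times the expansion of σ²ψH, so its sum is fH; the second is that
  -- expansion itself.
  refine ⟨hh2, memℓp_of_fourierCoeff_mul hf.memLp hfb hc,
    ⟨fun w => (f w : ℂ) * causalTransform h w,
      hasSumL2_of_hasSum (hsum.mapL (mulLp hΨ)) (fun l => ?_) ?_, ?_⟩,
    ⟨_, hasSumL2_of_hasSum hsum hF hG, ?_⟩⟩
  -- Since ψ^* φ^* = 1, the splitting of `phiHead` times ψ^* is the summand of the first formula.
  · filter_upwards [coeFn_mulLp hΨ (F l), hF l, phiHead_ae_eq hfac.phi_memlp hfac.phi_zero l,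
      hfac.mul_eq_one] with w h1 h2 h3 h4
    have h5 : conj (phiFun φ w) * conj (psiFun ψ w) = 1 := by
      rw [← map_mul, h4, map_one]
    rw [h1, h2, h3]
    linear_combination (crossCov P Y X l : ℂ) * fourier (l : ℤ) w * h5
  · filter_upwards [coeFn_mulLp hΨ G, hG, hfac.eq_psi] with w h1 h2 h3
    rw [h1, h2, h3]
    push_cast
    rw [← Complex.mul_conj']
    ring
  · filter_upwards [hfb.ae_pos] with w hw
    have : (f w : ℂ) ≠ 0 := by exact_mod_cast hw.ne'
    field_simp
  · filter_upwards [hfac.mul_eq_one] with w h1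
    have : (σ : ℂ) ≠ 0 := by exact_mod_cast hfac.sigma_pos.ne'
    field_simp
    linear_combination -causalTransform h w * h1
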